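/- Let $n,m\ge 1$ and let $\gamma$ be an $n\times n$ complex matrix-valued function, analytic in a neighbourhood of the unit circle $S^1$, with $\gamma(z)$ invertible for every $z\in S^1$, and such that the total change of $\arg\det\gamma(e^{i\theta})$ over $0\le\theta\le 2\pi$ is $0$. Write $\gamma(z)=\sum_{k\in\mathbb Z}\gamma^{(k)}z^k$ for its Fourier expansion on $S^1$, let $D_N(\gamma)=\det\big(\gamma^{(i-j)}\big)_{0\le i,j\le N}$ be its block Toeplitz determinants, let $$G(\gamma)=\exp\Big(\frac1{2\pi}\int_0^{2\pi}\log\det\gamma(e^{i\theta})\,d\theta\Big)$$ (with a continuous branch of the logarithm), and let $$D_\infty(\gamma)=\lim_{N\to\infty}\frac{D_N(\gamma)}{G(\gamma)^{N+1}},$$ a limit that exists by the Szegő–Widom theorem. Suppose that $D_\infty(\gamma)\neq 0$. Then for every $C\in\mathbb C^{n\times m}$ the Riemann–Hilbert problem $$\varphi_+(z)=\gamma(z)^{\mathrm T}\varphi_-(z)\quad(z\in S^1),\qquad \varphi_-(\infty)=C,$$ has at most one solution $(\varphi_+,\varphi_-)$, where $\varphi_+$ and $\varphi_-$ are $\mathbb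 C^{n\times m}$-valued, $\varphi_+$ is analytic in $|z|<1$ and continuous on $|z|\le 1$, and $\varphi_-$ is analytic in $|z|>1$, continuous on $|z|\ge 1$, and tends to $C$ as $z\to\infty$. -/

import Mathlib

namespace BlockToeplitz

noncomputable section

/-- The `k`-th Fourier coefficient (a matrix) of the restriction of `γ` to the unit circle:
`γ^(k) = (2πi)⁻¹ ∮ z^(-k-1) γ(z) dz = (2π)⁻¹ ∫ γ(e^{iθ}) e^{-ikθ} dθ`. -/
def laurentCoeff {n : ℕ} (γ : ℂ → Matrix (Fin n) (Fin n) ℂ) (k : ℤ) :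
    Matrix (Fin n) (Fin n) ℂ :=
  Matrix.of fun i j =>
    (2 * (Real.pi : ℂ) * Complex.I)⁻¹ * ∮ z in C(0, 1), z ^ (-k - 1) * γ z i j

/-- The truncated block Toeplitz matrix `T_N(γ)`: its block rows and columns are numbered
`0, …, N`, and the block at `(a, b)` is `γ^(a - b)`. -/
def toeplitzMatrix {n : ℕ} (γ : ℂ → Matrix (Fin n) (Fin n) ℂ) (N : ℕ) :
    Matrix (Fin (N + 1) × Fin n) (Fin (N + 1) × Fin n) ℂ :=
  Matrix.of fun p q => laurentCoeff γ (((p.1 : ℕ) : ℤ) - ((q.1 : ℕ) : ℤ)) p.2 q.2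

/-- The block Toeplitz determinant `D_N(γ)`. -/
def toeplitzDet {n : ℕ} (γ : ℂ → Matrix (Fin n) (Fin n) ℂ) (N : ℕ) : ℂ :=
  (toeplitzMatrix γ N).det

/-- `ℓ` is a continuous branch of `θ ↦ log det γ(e^{iθ})` on `[0, 2π]`. -/
def IsLogDetBranch {n : ℕ} (γ : ℂ → Matrix (Fin n) (Fin n) ℂ) (ℓ : ℝ → ℂ) : Prop :=
  ContinuousOn ℓ (Set.Icc 0 (2 * Real.pi)) ∧
    ∀ θ ∈ Set.Icc (0 : ℝ) (2 * Real.pi),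
      Complex.exp (ℓ θ) = (γ (Complex.exp ((θ : ℂ) * Complex.I))).det

/-- The total change of the argument of `det γ(e^{iθ})` over `0 ≤ θ ≤ 2π` is zero. -/
def ZeroArgVariation {n : ℕ} (γ : ℂ → Matrix (Fin n) (Fin n) ℂ) : Prop :=
  ∃ ℓ : ℝ → ℂ, IsLogDetBranch γ ℓ ∧ (ℓ (2 * Real.pi)).im = (ℓ 0).im

open Classical in
/-- `G(γ) = exp ((2π)⁻¹ ∫₀^{2π} log det γ(e^{iθ}) dθ)`, with a continuous branch of the logarithm
(the value does not depend on the branch, see `geometricMean_eq`). -/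
def geometricMean {n : ℕ} (γ : ℂ → Matrix (Fin n) (Fin n) ℂ) : ℂ :=
  if h : ∃ ℓ : ℝ → ℂ, IsLogDetBranch γ ℓ then
    Complex.exp ((2 * (Real.pi : ℂ))⁻¹ * ∫ θ in (0 : ℝ)..(2 * Real.pi), h.choose θ)
  else 0

/-- The Szegő–Widom constant `D_∞(γ)`: the limit of the block Toeplitz determinants, normalized by
one factor `G(γ)` for each of the `N + 1` block rows of `T_N(γ)`. For smooth invertible loops with
`ZeroArgVariation γ` this limit exists (Szegő–Widom theorem). -/
def szegoWidomConstant {n : ℕ} (γ : ℂ → Matrix (Fin n) (Fin n) ℂ) : ℂ :=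
  Filter.limUnder Filter.atTop fun N : ℕ => toeplitzDet γ N / geometricMean γ ^ (N + 1)

/-- `(φp, φm)` solves the Riemann–Hilbert problem `φ₊ = γᵀ φ₋` on the unit circle, normalized by
`φ₋(∞) = C`. The values are `n × m` matrices: `m = 1` is the case of vectors, `m = n` that of
square matrices. Both functions are analytic on their side of the circle and continuous up to it. -/
structure IsRHSolution {n m : ℕ} (γ : ℂ → Matrix (Fin n) (Fin n) ℂ)
    (C : Matrix (Fin n) (Fin m) ℂ) (φp φm : ℂ → Matrix (Fin n) (Fin m) ℂ) : Prop where
  inside : ∀ i j, DiffContOnCl ℂ (fun z => φp z i j) (Metric.ball 0 1)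
  outside : ∀ i j, DiffContOnCl ℂ (fun z => φm z i j) (Metric.closedBall 0 1)ᶜ
  jump : ∀ z ∈ Metric.sphere (0 : ℂ) 1, φp z = (γ z).transpose * φm z
  at_infinity : ∀ i j, Filter.Tendsto (fun z => φm z i j) (Filter.cocompact ℂ) (nhds (C i j))

/-- `geometricMean` may be computed with any continuous branch of the logarithm. -/
theorem geometricMean_eq {n : ℕ} {γ : ℂ → Matrix (Fin n) (Fin n) ℂ} {ℓ : ℝ → ℂ}
    (hℓ : IsLogDetBranch γ ℓ) :
    geometricMean γ =
      Complex.exp ((2 * (Real.pi : ℂ))⁻¹ * ∫ θ in (0 : ℝ)..(2 * Real.pi), ℓ θ) := by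
  have h : ∃ ℓ : ℝ → ℂ, IsLogDetBranch γ ℓ := ⟨ℓ, hℓ⟩
  have h0 : (0 : ℝ) ≤ 2 * Real.pi := by positivity
  have hpi : (2 * (Real.pi : ℂ) * Complex.I) ≠ 0 := by simp [Real.pi_ne_zero]
  rw [geometricMean, dif_pos h]
  obtain ⟨hc, he⟩ := h.choose_spec
  set k := h.choose
  obtain ⟨hc', he'⟩ := hℓ
  let d : ℝ → ℂ := fun θ => (k θ - ℓ θ) / (2 * (Real.pi : ℂ) * Complex.I)
  have hd : ContinuousOn d (Set.Icc 0 (2 * Real.pi)) := (hc.sub hc').div_const _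
  have hint : ∀ θ ∈ Set.Icc (0 : ℝ) (2 * Real.pi), ∃ m : ℤ, d θ = m := by
    intro θ hθ
    obtain ⟨m, hm⟩ := Complex.exp_eq_exp_iff_exists_int.1 ((he θ hθ).trans (he' θ hθ).symm)
    refine ⟨m, ?_⟩
    simp only [d, hm]
    field_simp
    ring
  have hconst : ∃ m : ℤ, ∀ θ ∈ Set.Icc (0 : ℝ) (2 * Real.pi), d θ = m := by
    obtain ⟨m, hm⟩ := hint 0 ⟨le_rfl, h0⟩
    refine ⟨m, fun θ hθ => ?_⟩
    have hs : IsPreconnected (d '' Set.Icc (0 : ℝ) (2 * Real.pi)) :=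
      isPreconnected_Icc.image d hd
    have hsub : d '' Set.Icc (0 : ℝ) (2 * Real.pi) ⊆ Set.range ((↑) : ℤ → ℂ) := by
      rintro _ ⟨x, hx, rfl⟩
      obtain ⟨p, hp⟩ := hint x hx
      exact ⟨p, hp.symm⟩
    have hcount : (d '' Set.Icc (0 : ℝ) (2 * Real.pi)).Countable :=
      (Set.countable_range _).mono hsub
    rw [← hm]
    exact hcount.isTotallyDisconnected _ subset_rfl hs
      (Set.mem_image_of_mem d hθ) (Set.mem_image_of_mem d ⟨le_rfl, h0⟩)
  obtain ⟨m, hm⟩ := hconst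
  have hk : (∫ θ in (0 : ℝ)..(2 * Real.pi), k θ) =
      (∫ θ in (0 : ℝ)..(2 * Real.pi), ℓ θ) +
        (2 * (Real.pi : ℂ)) * (m * (2 * (Real.pi : ℂ) * Complex.I)) := by
    have h1 : (∫ θ in (0 : ℝ)..(2 * Real.pi), k θ) =
        ∫ θ in (0 : ℝ)..(2 * Real.pi), (ℓ θ + m * (2 * (Real.pi : ℂ) * Complex.I)) := by
      refine intervalIntegral.integral_congr fun θ hθ => ?_
      rw [Set.uIcc_of_le h0] at hθ
      have h2 := hm θ hθ
      simp only [d] at h2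
      rw [div_eq_iff hpi] at h2
      exact sub_eq_iff_eq_add'.1 h2
    have hi : IntervalIntegrable ℓ MeasureTheory.volume 0 (2 * Real.pi) := by
      refine ContinuousOn.intervalIntegrable ?_
      rwa [Set.uIcc_of_le h0]
    rw [h1, intervalIntegral.integral_add hi intervalIntegrable_const,
      intervalIntegral.integral_const]
    simp
  rw [hk, mul_add, Complex.exp_add, inv_mul_cancel_left₀ (by simp [Real.pi_ne_zero]),
    Complex.exp_int_mul_two_pi_mul_I, mul_one]

end

end BlockToeplitz


/-!
By linearity two solutions differ by a solution of the homogeneous problem `φ₋(∞) = 0`, which is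
shown to force `D_N(γ) / G(γ) ^ (N + 1) → 0` unless it vanishes.

A solution of the homogeneous problem extends analytically across the circle, since
`φ₋ = (γᵀ)⁻¹ φ₊` in an annulus inside it; hence the Taylor coefficients of `φ₋` at infinity decay
geometrically. Comparison of the Fourier coefficients of `φ₊ = γᵀ φ₋` shows that these coefficients
form a left null vector of the infinite Toeplitz matrix, and their truncations are left null vectors
of `T_N(γ)` up to an error `O(r ^ N)` with `r < 1`.

It remains to see that a matrix with such an approximate null vector has a determinant which is
exponentially small compared with `G(γ) ^ (N + 1)`. Multiply `T_N(γ)` on the left by the unitary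
discrete Fourier transform followed by the matrices `γ(ζ_j)⁻¹` at the `N + 1` equidistant nodes
`ζ_j`. The `j`-th block row of the product consists of Fourier coefficients of
`d_j(z) γ(ζ_j)⁻¹ γ(z)`, where the normalized Dirichlet kernel `d_j` is concentrated near `ζ_j`. By
Bessel's inequality the squared Frobenius norm of the product is therefore at most
`(N + 1) n + o(N)`, and the inequality of arithmetic and geometric means bounds its determinant by
`exp (o(N))`, with a further factor `O(N r ^ N)` gained from the approximate null vector. The
determinant of the preconditioner has modulus `∏ j, |det γ(ζ_j)|⁻¹`, a Riemann sum for
`|G(γ)| ^ (-(N + 1))`.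
-/

namespace BlockToeplitz

open Filter Finset MeasureTheory Metric Real Topology WithLp
open scoped ComplexOrder Kronecker Matrix Matrix.Norms.Frobenius

section CircleCoeff

variable {E : Type*} [NormedAddCommGroup E] [NormedSpace ℂ E]

/-- The `k`-th Fourier coefficient of the restriction of `f` to the unit circle. -/
noncomputable def circleCoeff (f : ℂ → E) (k : ℤ) : E :=
  circleAverage (fun z => z ^ (-k) • f z) 0 1

theorem ne_zero_of_mem_unit_sphere {z : ℂ} (hz : z ∈ sphere (0 : ℂ) 1) : z ≠ 0 :=
  ne_of_mem_sphere hz one_ne_zero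

theorem continuousOn_zpow_sphere (k : ℤ) : ContinuousOn (fun z : ℂ => z ^ k) (sphere 0 1) :=
  fun z hz => (continuousAt_zpow₀ z k (.inl (ne_zero_of_mem_unit_sphere hz))).continuousWithinAt

theorem circleAverage_congr_unit_sphere {F : Type*} [NormedAddCommGroup F] [NormedSpace ℝ F]
    {f g : ℂ → F} (hfg : Set.EqOn f g (sphere 0 1)) : circleAverage f 0 1 = circleAverage g 0 1 :=
  circleAverage_congr_sphere (by rwa [abs_one])

theorem circleCoeff_congr {f g : ℂ → E} (hfg : Set.EqOn f g (sphere 0 1)) (k : ℤ) :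
    circleCoeff f k = circleCoeff g k :=
  circleAverage_congr_unit_sphere fun z hz => by simp only [hfg hz]

theorem circleIntegrable_zpow_smul {f : ℂ → E} (hf : ContinuousOn f (sphere 0 1)) (k : ℤ) :
    CircleIntegrable (fun z => z ^ k • f z) 0 1 :=
  ((continuousOn_zpow_sphere k).smul hf).circleIntegrable zero_le_one

theorem circleCoeff_sum {ι : Type*} {s : Finset ι} {f : ι → ℂ → E}
    (hf : ∀ i ∈ s, ContinuousOn (f i) (sphere 0 1)) (k : ℤ) :
    circleCoeff (fun z => ∑ i ∈ s, f i z) k = ∑ i ∈ s, circleCoeff (f i) k := by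
  simp only [circleCoeff, smul_sum]
  exact circleAverage_fun_sum fun i hi => circleIntegrable_zpow_smul (hf i hi) (-k)

theorem circleCoeff_sub {f g : ℂ → E} (hf : ContinuousOn f (sphere 0 1))
    (hg : ContinuousOn g (sphere 0 1)) (k : ℤ) :
    circleCoeff (fun z => f z - g z) k = circleCoeff f k - circleCoeff g k := by
  simp only [circleCoeff, smul_sub]
  exact circleAverage_fun_sub (circleIntegrable_zpow_smul hf (-k))
    (circleIntegrable_zpow_smul hg (-k))

theorem circleCoeff_const_mul (c : ℂ) (f : ℂ → ℂ) (k : ℤ) :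
    circleCoeff (fun z => c * f z) k = c * circleCoeff f k := by
  simp only [circleCoeff, smul_eq_mul, mul_left_comm _ c]
  exact circleAverage_fun_smul (a := c) (f := fun z => z ^ (-k) * f z)

theorem circleCoeff_zpow_smul (m k : ℤ) (f : ℂ → E) :
    circleCoeff (fun z => z ^ m • f z) k = circleCoeff f (k - m) :=
  circleAverage_congr_unit_sphere fun z hz => by
    simp only [smul_smul, ← zpow_add₀ (ne_zero_of_mem_unit_sphere hz), neg_sub]
    rw [neg_add_eq_sub]

theorem circleCoeff_comp_inv (f : ℂ → E) (k : ℤ) :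
    circleCoeff (fun z => f z⁻¹) k = circleCoeff f (-k) := by
  rw [circleCoeff, circleCoeff, ← circleAverage_zero_one_congr_inv]
  simp only [inv_inv, inv_zpow', neg_neg]

theorem circleCoeff_one (k : ℤ) : circleCoeff (fun _ => (1 : ℂ)) k = if k = 0 then 1 else 0 := by
  have hint : ∮ z in C(0, 1), (z - 0)⁻¹ • z ^ (-k) • (1 : ℂ) = ∮ z in C(0, 1), (z - 0) ^ (-k - 1) :=
    circleIntegral.integral_congr zero_le_one fun z hz => by
      simp only [sub_zero, smul_eq_mul, mul_one, zpow_sub_one₀ (ne_zero_of_mem_unit_sphere hz),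
        mul_comm]
  rw [circleCoeff, circleAverage_eq_circleIntegral one_ne_zero, hint]
  split_ifs with hk
  · have hres := circleIntegral.integral_sub_center_inv (0 : ℂ) (one_ne_zero (α := ℝ))
    simp only [hk, neg_zero, zero_sub, zpow_neg_one]
    rw [hres, smul_eq_mul, inv_mul_cancel₀ (by simp [pi_ne_zero])]
  · rw [circleIntegral.integral_sub_zpow_of_ne (by omega), smul_zero]

theorem circleCoeff_zpow (m k : ℤ) :
    circleCoeff (fun z : ℂ => z ^ m) k = if k = m then 1 else 0 := by
  simpa [sub_eq_zero] using
    (circleCoeff_zpow_smul m k fun _ => (1 : ℂ)).trans (circleCoeff_one (k - m))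

theorem circleCoeff_neg_natCast_eq_zero [CompleteSpace E] {f : ℂ → E}
    (hf : DiffContOnCl ℂ f (ball 0 1)) (h0 : f 0 = 0) (q : ℕ) : circleCoeff f (-q) = 0 := by
  have hd : DiffContOnCl ℂ (fun z => z ^ q • f z) (ball 0 |1|) := by
    rw [abs_one]
    exact (differentiable_pow q).diffContOnCl.smul hf
  simpa [circleCoeff, h0] using hd.circleAverage

theorem hasSum_norm_circleCoeff_sq {f : ℂ → ℂ} (hf : ContinuousOn f (sphere 0 1)) :
    HasSum (fun k : ℤ => ‖circleCoeff f k‖ ^ 2) (circleAverage (fun z => ‖f z‖ ^ 2) 0 1) := by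
  have hcont : Continuous fun θ => f (circleMap 0 1 θ) :=
    hf.comp_continuous (continuous_circleMap 0 1) (circleMap_mem_sphere 0 zero_le_one)
  have hL2 : MemLp (fun θ => f (circleMap 0 1 θ)) 2 (volume.restrict (Set.Ioc 0 (2 * π))) := by
    obtain ⟨B, hB⟩ := (isCompact_sphere (0 : ℂ) 1).exists_bound_of_continuousOn hf
    exact .of_bound hcont.aestronglyMeasurable B
      (.of_forall fun θ => hB _ (circleMap_mem_sphere 0 zero_le_one θ))
  have hcoeff : ∀ k, fourierCoeffOn two_pi_pos (fun θ => f (circleMap 0 1 θ)) k =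
      circleCoeff f k := fun k => by
    rw [fourierCoeffOn_eq_integral, circleCoeff, circleAverage_def, sub_zero, one_div]
    congr 1
    refine intervalIntegral.integral_congr fun θ _ => ?_
    simp only [fourier_coe_apply, circleMap, ← Complex.exp_int_mul, zero_add, Complex.ofReal_one,
      one_mul]
    congr 2
    push_cast
    field_simp
  simpa only [hcoeff, sub_zero, circleAverage_def] using hasSum_sq_fourierCoeffOn two_pi_pos hL2

theorem sum_norm_circleCoeff_sq_le {ι : Type*} [Fintype ι] {f : ℂ → ℂ}
    (hf : ContinuousOn f (sphere 0 1)) (e : ι ↪ ℤ) :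
    ∑ i, ‖circleCoeff f (e i)‖ ^ 2 ≤ circleAverage (fun z => ‖f z‖ ^ 2) 0 1 := by
  rw [← sum_map univ e fun k => ‖circleCoeff f k‖ ^ 2]
  exact sum_le_hasSum _ (fun k _ => sq_nonneg _) (hasSum_norm_circleCoeff_sq hf)

theorem circleAverage_norm_sum_zpow_sq {ι : Type*} (s : Finset ι) (c : ι → ℂ) (e : ι ↪ ℤ) :
    circleAverage (fun z => ‖∑ i ∈ s, c i * z ^ e i‖ ^ 2) 0 1 = ∑ i ∈ s, ‖c i‖ ^ 2 := by
  have hmono (i) : ContinuousOn (fun z : ℂ => c i * z ^ e i) (sphere 0 1) :=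
    continuousOn_const.mul (continuousOn_zpow_sphere (e i))
  have hcoeff (k) : circleCoeff (fun z => ∑ i ∈ s, c i * z ^ e i) k =
      ∑ i ∈ s, if k = e i then c i else 0 := by
    simp only [circleCoeff_sum fun i _ => hmono i, circleCoeff_const_mul, circleCoeff_zpow,
      mul_ite, mul_one, mul_zero]
  have hsum : HasSum (fun k => ‖circleCoeff (fun z => ∑ i ∈ s, c i * z ^ e i) k‖ ^ 2)
      (∑ k ∈ s.map e, ‖circleCoeff (fun z => ∑ i ∈ s, c i * z ^ e i) k‖ ^ 2) :=
    hasSum_sum_of_ne_finset_zero fun k hk => by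
      have hne : ∀ i ∈ s, k ≠ e i := fun i hi h => hk (mem_map.2 ⟨i, hi, h.symm⟩)
      simp only [hcoeff, sum_ite_of_false hne, sum_const_zero, norm_zero, ne_eq,
        OfNat.ofNat_ne_zero, not_false_eq_true, zero_pow]
  rw [(hasSum_norm_circleCoeff_sq (continuousOn_finsetSum s fun i _ => hmono i)).unique hsum,
    sum_map]
  refine sum_congr rfl fun i hi => ?_
  have hne : ∀ j ∈ s, j ≠ i → (if e i = e j then c j else 0) = 0 :=
    fun j _ hj => if_neg (e.injective.ne hj.symm)
  simp only [hcoeff, sum_eq_single_of_mem i hi hne, if_true]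

theorem norm_circleAverage_le {F : Type*} [NormedAddCommGroup F] [NormedSpace ℝ F] {f : ℂ → F}
    {R B : ℝ} (hR : 0 ≤ R) (hf : ∀ z ∈ sphere (0 : ℂ) R, ‖f z‖ ≤ B) :
    ‖circleAverage f 0 R‖ ≤ B := by
  rw [circleAverage_def, norm_smul, norm_inv, Real.norm_eq_abs, abs_of_pos two_pi_pos,
    inv_mul_le_iff₀ two_pi_pos]
  refine (intervalIntegral.norm_integral_le_of_norm_le_const (C := B) fun θ _ =>
    hf _ (circleMap_mem_sphere 0 hR θ)).trans_eq ?_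
  rw [sub_zero, abs_of_pos two_pi_pos, mul_comm]

end CircleCoeff

section BlockPolynomials

variable {n N : ℕ} {γ : ℂ → Matrix (Fin n) (Fin n) ℂ}

/-- The polynomial in `z⁻¹` with block coefficients `x`, as a row vector: multiplying it by `γ` and
taking Fourier coefficients implements the product of `x` with the block Toeplitz matrix. -/
noncomputable def blockPoly (x : Fin (N + 1) × Fin n → ℂ) (z : ℂ) : Fin n → ℂ :=
  fun i => ∑ p : Fin (N + 1), x (p, i) * z ^ (-(p : ℤ))

theorem laurentCoeff_apply (γ : ℂ → Matrix (Fin n) (Fin n) ℂ) (k : ℤ) (i j : Fin n) :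
    laurentCoeff γ k i j = circleCoeff (fun z => γ z i j) k := by
  rw [circleCoeff, circleAverage_eq_circleIntegral one_ne_zero, laurentCoeff, Matrix.of_apply,
    smul_eq_mul]
  congr 1
  refine circleIntegral.integral_congr zero_le_one fun z hz => ?_
  simp only [zpow_sub_one₀ (ne_zero_of_mem_unit_sphere hz), sub_zero, smul_eq_mul]
  ring

theorem continuousOn_blockPoly (x : Fin (N + 1) × Fin n → ℂ) :
    ContinuousOn (blockPoly x) (sphere 0 1) :=
  continuousOn_pi.2 fun _ =>
    continuousOn_finsetSum _ fun p _ => continuousOn_const.mul (continuousOn_zpow_sphere (-p))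

theorem continuousOn_blockPoly_vecMul (hγ : ContinuousOn γ (sphere 0 1))
    (x : Fin (N + 1) × Fin n → ℂ) :
    ContinuousOn (fun z => blockPoly x z ᵥ* γ z) (sphere 0 1) :=
  continuousOn_pi.2 fun l => continuousOn_finsetSum univ fun i _ =>
    (continuousOn_pi.1 (continuousOn_blockPoly x) i).mul
      (continuousOn_pi.1 (continuousOn_pi.1 hγ i) l)

theorem vecMul_toeplitzMatrix_apply (hγ : ContinuousOn γ (sphere 0 1))
    (x : Fin (N + 1) × Fin n → ℂ) (q : Fin (N + 1)) (l : Fin n) :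
    (x ᵥ* toeplitzMatrix γ N) (q, l) = circleCoeff (fun z => (blockPoly x z ᵥ* γ z) l) (-q) := by
  have hcont (p : Fin (N + 1)) (i : Fin n) :
      ContinuousOn (fun z => x (p, i) * (z ^ (-(p : ℤ)) * γ z i l)) (sphere 0 1) :=
    continuousOn_const.mul ((continuousOn_zpow_sphere _).mul
      (continuousOn_pi.1 (continuousOn_pi.1 hγ i) l))
  simp only [Matrix.vecMul, dotProduct, blockPoly, sum_mul, mul_assoc, Fintype.sum_prod_type,
    toeplitzMatrix, Matrix.of_apply, laurentCoeff_apply]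
  rw [circleCoeff_sum fun i _ => continuousOn_finsetSum _ fun p _ => hcont p i, sum_comm]
  refine sum_congr rfl fun i _ => ?_
  rw [circleCoeff_sum fun p _ => hcont p i]
  refine sum_congr rfl fun p _ => ?_
  rw [circleCoeff_const_mul]
  exact congrArg (x (p, i) * ·) ((circleCoeff_zpow_smul (-p) (-q) _).trans
    (by rw [sub_neg_eq_add, neg_add_eq_sub])).symm

/-- The negative Fourier coefficients are the ones a Toeplitz section sees, so `h` is free. -/
theorem norm_vecMul_toeplitzMatrix_sq_le (hγ : ContinuousOn γ (sphere 0 1))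
    (x : Fin (N + 1) × Fin n → ℂ) {h : ℂ → Fin n → ℂ} (hh : ContinuousOn h (sphere 0 1))
    (hcoeff : ∀ (l : Fin n) (q : ℕ), circleCoeff (fun z => h z l) (-q) = 0) :
    ‖toLp 2 (x ᵥ* toeplitzMatrix γ N)‖ ^ 2 ≤
      circleAverage (fun z => ‖toLp 2 (blockPoly x z ᵥ* γ z - h z)‖ ^ 2) 0 1 := by
  have hmul (l : Fin n) : ContinuousOn (fun z => (blockPoly x z ᵥ* γ z) l) (sphere 0 1) :=
    continuousOn_pi.1 (continuousOn_blockPoly_vecMul hγ x) l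
  have hsub (l : Fin n) : ContinuousOn (fun z => (blockPoly x z ᵥ* γ z) l - h z l) (sphere 0 1) :=
    (hmul l).sub (continuousOn_pi.1 hh l)
  have hentry (q : Fin (N + 1)) (l : Fin n) : (x ᵥ* toeplitzMatrix γ N) (q, l) =
      circleCoeff (fun z => (blockPoly x z ᵥ* γ z) l - h z l) (-q) := by
    rw [vecMul_toeplitzMatrix_apply hγ, circleCoeff_sub (hmul l) (continuousOn_pi.1 hh l), hcoeff,
      sub_zero]
  let negCast : Fin (N + 1) ↪ ℤ := ⟨fun q => -(q : ℤ), fun p q h => by simpa [Fin.ext_iff] using h⟩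
  simp only [EuclideanSpace.norm_sq_eq, Pi.sub_apply]
  rw [circleAverage_fun_sum (f := fun l z => ‖(blockPoly x z ᵥ* γ z) l - h z l‖ ^ 2)
    fun l _ => ((hsub l).norm.pow 2).circleIntegrable zero_le_one, Fintype.sum_prod_type_right]
  simp only [hentry]
  exact sum_le_sum fun l _ => sum_norm_circleCoeff_sq_le (hsub l) negCast

end BlockPolynomials

section DirichletKernel

/-- The Dirichlet kernel with peak at `ζ`; it is left unnormalized, with mean square `N + 1`. -/
noncomputable def dirichletKernel (N : ℕ) (ζ z : ℂ) : ℂ :=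
  ∑ p : Fin (N + 1), ζ ^ (p : ℕ) * z ^ (-(p : ℤ))

variable {N : ℕ} {ζ : ℂ}

theorem continuousOn_dirichletKernel (N : ℕ) (ζ : ℂ) :
    ContinuousOn (dirichletKernel N ζ) (sphere 0 1) :=
  continuousOn_finsetSum _ fun p _ => continuousOn_const.mul (continuousOn_zpow_sphere (-p))

theorem circleAverage_norm_dirichletKernel_sq (hζ : ζ ∈ sphere (0 : ℂ) 1) :
    circleAverage (fun z => ‖dirichletKernel N ζ z‖ ^ 2) 0 1 = N + 1 := by
  let negCast : Fin (N + 1) ↪ ℤ := ⟨fun p => -(p : ℤ), fun p q h => by simpa [Fin.ext_iff] using h⟩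
  have hnorm (p : Fin (N + 1)) : ‖ζ ^ (p : ℕ)‖ ^ 2 = 1 := by
    rw [norm_pow, mem_sphere_zero_iff_norm.1 hζ, one_pow, one_pow]
  calc circleAverage (fun z => ‖dirichletKernel N ζ z‖ ^ 2) 0 1
      = ∑ p : Fin (N + 1), ‖ζ ^ (p : ℕ)‖ ^ 2 :=
        circleAverage_norm_sum_zpow_sq univ (fun p : Fin (N + 1) => ζ ^ (p : ℕ)) negCast
    _ = N + 1 := by
      simp only [hnorm, sum_const, card_univ, Fintype.card_fin, nsmul_one, Nat.cast_succ]

theorem norm_sub_sq_mul_norm_dirichletKernel_sq_le {z : ℂ} (hζ : ζ ∈ sphere (0 : ℂ) 1)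
    (hz : z ∈ sphere (0 : ℂ) 1) : ‖z - ζ‖ ^ 2 * ‖dirichletKernel N ζ z‖ ^ 2 ≤ 4 := by
  have hz0 := ne_zero_of_mem_unit_sphere hz
  rw [mem_sphere_zero_iff_norm] at hζ hz
  have htelescope : (z - ζ) * dirichletKernel N ζ z = z * (1 - (ζ * z⁻¹) ^ (N + 1)) := by
    simp only [dirichletKernel, zpow_neg, zpow_natCast, ← inv_pow, ← mul_pow]
    rw [Fin.sum_univ_eq_sum_range (fun p => (ζ * z⁻¹) ^ p), ← mul_neg_geom_sum, ← mul_assoc,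
      mul_sub, mul_one, mul_left_comm, mul_inv_cancel₀ hz0, mul_one]
  have htwo : ‖(z - ζ) * dirichletKernel N ζ z‖ ≤ 2 := by
    rw [htelescope, norm_mul, hz, one_mul]
    refine (norm_sub_le _ _).trans_eq ?_
    simp only [norm_one, norm_pow, norm_mul, hζ, norm_inv, hz, inv_one, mul_one, one_pow,
      one_add_one_eq_two]
  calc ‖z - ζ‖ ^ 2 * ‖dirichletKernel N ζ z‖ ^ 2 = ‖(z - ζ) * dirichletKernel N ζ z‖ ^ 2 := by
        rw [norm_mul, mul_pow]
    _ ≤ 2 ^ 2 := by gcongr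
    _ = 4 := by norm_num

theorem circleAverage_norm_dirichletKernel_sq_mul_le (hζ : ζ ∈ sphere (0 : ℂ) 1) {h : ℂ → ℝ}
    (hh : ContinuousOn h (sphere 0 1)) {a K : ℝ} (hK : 0 ≤ K)
    (hle : ∀ z ∈ sphere (0 : ℂ) 1, h z ≤ a + K * ‖z - ζ‖ ^ 2) :
    circleAverage (fun z => ‖dirichletKernel N ζ z‖ ^ 2 * h z) 0 1 ≤ (N + 1) * a + 4 * K := by
  have hkernel : ContinuousOn (fun z => ‖dirichletKernel N ζ z‖ ^ 2) (sphere 0 1) :=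
    (continuousOn_dirichletKernel N ζ).norm.pow 2
  have hpeak : CircleIntegrable (fun z => a * ‖dirichletKernel N ζ z‖ ^ 2) 0 1 :=
    (continuousOn_const.mul hkernel).circleIntegrable zero_le_one
  have hconst : CircleIntegrable (fun _ : ℂ => 4 * K) 0 1 :=
    continuousOn_const.circleIntegrable zero_le_one
  have hpoint (z) (hz : z ∈ sphere (0 : ℂ) |1|) : ‖dirichletKernel N ζ z‖ ^ 2 * h z ≤
      a * ‖dirichletKernel N ζ z‖ ^ 2 + 4 * K := by
    rw [abs_one] at hz
    calc ‖dirichletKernel N ζ z‖ ^ 2 * h z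
        ≤ ‖dirichletKernel N ζ z‖ ^ 2 * (a + K * ‖z - ζ‖ ^ 2) := by gcongr; exact hle z hz
      _ = a * ‖dirichletKernel N ζ z‖ ^ 2 + (‖z - ζ‖ ^ 2 * ‖dirichletKernel N ζ z‖ ^ 2) * K := by
          ring
      _ ≤ a * ‖dirichletKernel N ζ z‖ ^ 2 + 4 * K := by
          gcongr
          exact norm_sub_sq_mul_norm_dirichletKernel_sq_le hζ hz
  refine (circleAverage_mono ((hkernel.mul hh).circleIntegrable zero_le_one)
    (hpeak.add hconst) hpoint).trans_eq ?_
  rw [circleAverage_add hpeak hconst, circleAverage_const,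
    ← circleAverage_norm_dirichletKernel_sq (N := N) hζ, mul_comm _ a]
  exact congrArg (· + 4 * K) (circleAverage_fun_smul (a := a))

end DirichletKernel

theorem exists_le_add_mul_dist_sq {X : Type*} [PseudoMetricSpace X] {s : Set X} (hs : IsCompact s)
    {h : X → X → ℝ} (hh : ContinuousOn (Function.uncurry h) (s ×ˢ s)) {η : ℝ} (hη : 0 < η) :
    ∃ K, 0 ≤ K ∧ ∀ x ∈ s, ∀ y ∈ s, h x y ≤ h x x + η + K * dist y x ^ 2 := by
  obtain ⟨B, hB⟩ := (hs.prod hs).exists_bound_of_continuousOn hh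
  obtain ⟨δ, hδ, hunif⟩ := uniformContinuousOn_iff.1
    ((hs.prod hs).uniformContinuousOn_of_continuous hh) η hη
  refine ⟨2 * |B| / δ ^ 2, by positivity, fun x hx y hy => ?_⟩
  obtain hnear | hfar := lt_or_ge (dist y x) δ
  · have hclose : dist (h x y) (h x x) < η := hunif (x, y) ⟨hx, hy⟩ (x, x) ⟨hx, hx⟩ (by
      rw [Prod.dist_eq, dist_self, max_eq_right dist_nonneg]; exact hnear)
    have hnonneg : 0 ≤ 2 * |B| / δ ^ 2 * dist y x ^ 2 := by positivity
    linarith [(abs_lt.1 hclose).2]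
  · have hbound (y) (hy : y ∈ s) : |h x y| ≤ |B| := (hB (x, y) ⟨hx, hy⟩).trans (le_abs_self B)
    have hpenalty : 2 * |B| ≤ 2 * |B| / δ ^ 2 * dist y x ^ 2 := by
      rw [div_mul_eq_mul_div, le_div_iff₀ (by positivity)]
      gcongr
    linarith [(abs_le.1 (hbound y hy)).2, (abs_le.1 (hbound x hx)).1]

section MatrixBounds

variable {m n : Type*} [Fintype m] [Fintype n]

theorem frobenius_norm_sq (A : Matrix m n ℂ) : ‖A‖ ^ 2 = ∑ i, ∑ j, ‖A i j‖ ^ 2 := by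
  have : 0 ≤ ∑ i, ∑ j, ‖A i j‖ ^ 2 := by positivity
  rw [Matrix.frobenius_norm_def, ← rpow_natCast, ← rpow_mul (by positivity)]
  norm_num

theorem frobenius_norm_sq_eq_sum_row (A : Matrix m n ℂ) : ‖A‖ ^ 2 = ∑ i, ‖toLp 2 (A i)‖ ^ 2 := by
  simp only [frobenius_norm_sq, EuclideanSpace.norm_sq_eq]

theorem norm_vecMul_le (v : m → ℂ) (A : Matrix m n ℂ) :
    ‖toLp 2 (v ᵥ* A)‖ ≤ ‖toLp 2 v‖ * ‖A‖ := by
  rw [← Matrix.frobenius_norm_replicateRow (ι := Unit),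
    ← Matrix.frobenius_norm_replicateRow (ι := Unit), Matrix.replicateRow_vecMul]
  exact Matrix.frobenius_norm_mul _ _

theorem frobenius_norm_vecMulVec (u : m → ℂ) (v : n → ℂ) :
    ‖Matrix.vecMulVec u v‖ = ‖toLp 2 u‖ * ‖toLp 2 v‖ := by
  have hsq : ‖Matrix.vecMulVec u v‖ ^ 2 = (‖toLp 2 u‖ * ‖toLp 2 v‖) ^ 2 := by
    simp only [frobenius_norm_sq, Matrix.vecMulVec_apply, norm_mul, mul_pow,
      EuclideanSpace.norm_sq_eq, sum_mul_sum]
  exact (pow_left_inj₀ (norm_nonneg _) (by positivity) two_ne_zero).1 hsq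

variable [DecidableEq n]

/-- AM–GM for the squared singular values. -/
theorem norm_det_le_exp (R : Matrix n n ℂ) :
    ‖R.det‖ ≤ exp ((‖R‖ ^ 2 - Fintype.card n) / 2) := by
  have hpsd : (R * Rᴴ).PosSemidef := Matrix.posSemidef_self_mul_conjTranspose R
  have hdet : ‖R.det‖ ^ 2 = ∏ i, hpsd.isHermitian.eigenvalues i := by
    have h := hpsd.isHermitian.det_eq_prod_eigenvalues
    rw [Matrix.det_mul, Matrix.det_conjTranspose, Complex.star_def, Complex.mul_conj,
      Complex.normSq_eq_norm_sq] at h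
    exact Complex.ofReal_injective (by push_cast at h ⊢; exact h)
  have htrace : ‖R‖ ^ 2 = ∑ i, hpsd.isHermitian.eigenvalues i := by
    have h := hpsd.isHermitian.trace_eq_sum_eigenvalues
    simp only [Matrix.trace, Matrix.diag_apply, Matrix.mul_apply, Matrix.conjTranspose_apply,
      Complex.star_def, Complex.mul_conj, Complex.normSq_eq_norm_sq] at h
    rw [frobenius_norm_sq]
    exact Complex.ofReal_injective (by push_cast at h ⊢; exact h)
  have hsq : ‖R.det‖ ^ 2 ≤ exp ((‖R‖ ^ 2 - Fintype.card n) / 2) ^ 2 := by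
    calc ‖R.det‖ ^ 2 ≤ ∏ i, exp (hpsd.isHermitian.eigenvalues i - 1) :=
          hdet.trans_le (prod_le_prod (fun i _ => hpsd.eigenvalues_nonneg i) fun i _ => by
            linarith [add_one_le_exp (hpsd.isHermitian.eigenvalues i - 1)])
      _ = exp ((‖R‖ ^ 2 - Fintype.card n) / 2) ^ 2 := by
          rw [← exp_sum, ← exp_nat_mul, htrace, sum_sub_distrib, sum_const, card_univ,
            nsmul_one, Nat.cast_ofNat, mul_div_cancel₀ _ two_ne_zero]
  exact (pow_le_pow_iff_left₀ (norm_nonneg _) (exp_nonneg _) two_ne_zero).1 hsq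

theorem det_add_vecMulVec_single_vecMul (A : Matrix n n ℂ) (x : n → ℂ) (k : n) (c : ℂ) :
    (A + Matrix.vecMulVec (Pi.single k c) (x ᵥ* A)).det = (1 + c * x k) * A.det := by
  have hfactor : A + Matrix.vecMulVec (Pi.single k c) (x ᵥ* A) =
      (1 + Matrix.vecMulVec (Pi.single k c) x) * A := by
    rw [add_mul, one_mul, Matrix.vecMulVec_mul]
  rw [hfactor, Matrix.det_mul, Matrix.vecMulVec_eq Unit,
    Matrix.det_one_add_replicateCol_mul_replicateRow, dotProduct_single, mul_comm c]

/-- A vector `x` that `A` nearly annihilates gives a cheap rank-one perturbation of `A` that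
multiplies its determinant by a large factor. -/
theorem mul_norm_mul_norm_det_mul_le (S A : Matrix n n ℂ) (x : n → ℂ) (k : n) {t : ℝ}
    (ht : 0 ≤ t) :
    t * ‖x k‖ * ‖(S * A).det‖ ≤
      exp (((‖S * A‖ + t * ‖S‖ * ‖toLp 2 (x ᵥ* A)‖) ^ 2 - Fintype.card n) / 2) := by
  obtain ⟨u, hu, hux⟩ := Complex.exists_norm_eq_mul_self (x k)
  set E := Matrix.vecMulVec (Pi.single k (t * u)) (x ᵥ* A) with hE
  have hdet : (S * (A + E)).det = (1 + t * ‖x k‖) * (S * A).det := by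
    rw [Matrix.det_mul, hE, det_add_vecMulVec_single_vecMul, mul_assoc, ← hux, Matrix.det_mul]
    ring
  have hfactor : t * ‖x k‖ ≤ ‖(1 + t * ‖x k‖ : ℂ)‖ := by
    rw [← Complex.ofReal_mul, ← Complex.ofReal_one, ← Complex.ofReal_add, Complex.norm_real]
    exact (by linarith : _ ≤ 1 + t * ‖x k‖).trans (le_abs_self _)
  have hEnorm : ‖E‖ = t * ‖toLp 2 (x ᵥ* A)‖ := by
    rw [hE, frobenius_norm_vecMulVec, PiLp.toLp_single, PiLp.norm_single, norm_mul, hu, mul_one,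
      Complex.norm_real, norm_of_nonneg ht]
  have hnorm : ‖S * (A + E)‖ ≤ ‖S * A‖ + t * ‖S‖ * ‖toLp 2 (x ᵥ* A)‖ := by
    calc ‖S * (A + E)‖ ≤ ‖S * A‖ + ‖S * E‖ := by rw [mul_add]; exact norm_add_le _ _
      _ ≤ ‖S * A‖ + ‖S‖ * ‖E‖ := by gcongr; exact Matrix.frobenius_norm_mul S E
      _ = ‖S * A‖ + t * ‖S‖ * ‖toLp 2 (x ᵥ* A)‖ := by rw [hEnorm]; ring
  calc t * ‖x k‖ * ‖(S * A).det‖ ≤ ‖(S * (A + E)).det‖ := by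
        rw [hdet, norm_mul]; gcongr
    _ ≤ exp ((‖S * (A + E)‖ ^ 2 - Fintype.card n) / 2) := norm_det_le_exp _
    _ ≤ _ := by gcongr

end MatrixBounds

section Preconditioner

/-- The `j`-th of the `N + 1` equidistant nodes on the unit circle. -/
noncomputable def circleNode (N j : ℕ) : ℂ :=
  circleMap 0 1 (2 * π * j / (N + 1))

theorem circleNode_mem_sphere (N j : ℕ) : circleNode N j ∈ sphere (0 : ℂ) 1 :=
  circleMap_mem_sphere 0 zero_le_one _

theorem norm_circleNode (N j : ℕ) : ‖circleNode N j‖ = 1 :=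
  mem_sphere_zero_iff_norm.1 (circleNode_mem_sphere N j)

theorem circleNode_eq_pow (N j : ℕ) :
    circleNode N j = Complex.exp (2 * π * Complex.I / ((N + 1 : ℕ) : ℂ)) ^ j := by
  rw [circleNode, circleMap_zero, Complex.ofReal_one, one_mul, ← Complex.exp_nat_mul]
  push_cast
  ring_nf

theorem star_circleNode_pow (N j p : ℕ) :
    star (circleNode N j ^ p) = (circleNode N j)⁻¹ ^ p := by
  rw [star_pow, Complex.star_def, Complex.inv_def, Complex.normSq_eq_norm_sq, norm_circleNode]
  simp

theorem sum_circleNode_pow_mul_star (N : ℕ) (j k : Fin (N + 1)) :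
    ∑ p : Fin (N + 1), circleNode N j ^ (p : ℕ) * star (circleNode N k ^ (p : ℕ)) =
      if j = k then (N + 1 : ℂ) else 0 := by
  have hω := Complex.isPrimitiveRoot_exp (N + 1) N.succ_ne_zero
  have hk0 : circleNode N k ≠ 0 := ne_zero_of_mem_unit_sphere (circleNode_mem_sphere N k)
  set w : ℂ := circleNode N j * (circleNode N k)⁻¹ with hw
  simp only [star_circleNode_pow, ← mul_pow, ← hw]
  rw [Fin.sum_univ_eq_sum_range (fun p => w ^ p)]
  split_ifs with hjk
  · simp [hw, hjk, mul_inv_cancel₀ hk0]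
  · have hw1 : w ≠ 1 := fun h => hjk <| Fin.ext <| hω.pow_inj j.2 k.2 <| by
      rwa [hw, ← div_eq_mul_inv, div_eq_one_iff_eq hk0, circleNode_eq_pow, circleNode_eq_pow] at h
    have hroot (i : ℕ) : circleNode N i ^ (N + 1) = 1 := by
      rw [circleNode_eq_pow, ← pow_mul, mul_comm i, pow_mul, hω.pow_eq_one, one_pow]
    have hwN : w ^ (N + 1) = 1 := by rw [hw, mul_pow, inv_pow, hroot, hroot, inv_one, mul_one]
    rw [geom_sum_eq hw1, hwN, sub_self, zero_div]

/-- The matrix of the discrete Fourier transform, normalized to be unitary. -/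
noncomputable def dftMatrix (N : ℕ) : Matrix (Fin (N + 1)) (Fin (N + 1)) ℂ :=
  Matrix.of fun j p => (√(N + 1 : ℝ) : ℂ)⁻¹ * circleNode N j ^ (p : ℕ)

theorem norm_dftMatrix_apply_sq (N : ℕ) (j p : Fin (N + 1)) :
    ‖dftMatrix N j p‖ ^ 2 = (N + 1 : ℝ)⁻¹ := by
  rw [dftMatrix, Matrix.of_apply, norm_mul, norm_inv, Complex.norm_real, norm_pow, norm_circleNode,
    one_pow, mul_one, inv_pow, norm_of_nonneg (sqrt_nonneg _), sq_sqrt (by positivity)]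

theorem dftMatrix_mem_unitaryGroup (N : ℕ) :
    dftMatrix N ∈ Matrix.unitaryGroup (Fin (N + 1)) ℂ := by
  have hsqrt : (√(N + 1 : ℝ) : ℂ)⁻¹ * (√(N + 1 : ℝ) : ℂ)⁻¹ = (N + 1 : ℂ)⁻¹ := by
    rw [← mul_inv, ← Complex.ofReal_mul, mul_self_sqrt (by positivity)]
    push_cast
    rfl
  refine Matrix.mem_unitaryGroup_iff.2 (Matrix.ext fun j k => ?_)
  calc (dftMatrix N * star (dftMatrix N)) j k
      = (N + 1 : ℂ)⁻¹ * ∑ p : Fin (N + 1),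
          circleNode N j ^ (p : ℕ) * star (circleNode N k ^ (p : ℕ)) := by
        simp only [Matrix.mul_apply, Matrix.star_apply, dftMatrix, Matrix.of_apply, star_mul',
          mul_sum, ← hsqrt, Complex.star_def, map_inv₀, Complex.conj_ofReal]
        exact sum_congr rfl fun p _ => by ring
    _ = (1 : Matrix _ _ ℂ) j k := by
        have hN : (N + 1 : ℂ) ≠ 0 := N.cast_add_one_ne_zero
        rw [sum_circleNode_pow_mul_star, mul_ite, inv_mul_cancel₀ hN, mul_zero, Matrix.one_apply]

theorem norm_det_dftMatrix (N : ℕ) : ‖(dftMatrix N).det‖ = 1 :=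
  CStarRing.norm_of_mem_unitary (Matrix.det_of_mem_unitary (dftMatrix_mem_unitaryGroup N))

variable {n : ℕ} {γ : ℂ → Matrix (Fin n) (Fin n) ℂ}

/-- The discrete Fourier transform followed by multiplication with `γ⁻¹` at each node. It
approximately inverts the block Toeplitz matrix of `γ`, up to a unitary factor. -/
noncomputable def preconditioner (γ : ℂ → Matrix (Fin n) (Fin n) ℂ) (N : ℕ) :
    Matrix (Fin (N + 1) × Fin n) (Fin (N + 1) × Fin n) ℂ :=
  Matrix.of fun p q => dftMatrix N p.1 q.1 * (γ (circleNode N p.1))⁻¹ p.2 q.2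

theorem norm_det_preconditioner (γ : ℂ → Matrix (Fin n) (Fin n) ℂ) (N : ℕ) :
    ‖(preconditioner γ N).det‖ = ∏ j : Fin (N + 1), ‖(γ (circleNode N j)).det‖⁻¹ := by
  have hfactor : preconditioner γ N =
      (Matrix.blockDiagonal fun j : Fin (N + 1) => (γ (circleNode N j))⁻¹).submatrix
        (Equiv.prodComm _ _) (Equiv.prodComm _ _) *
        (dftMatrix N ⊗ₖ (1 : Matrix (Fin n) (Fin n) ℂ)) := by
    ext ⟨j, i⟩ ⟨p, l⟩
    simp only [preconditioner, Matrix.of_apply, Matrix.mul_apply, Matrix.submatrix_apply,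
      Fintype.sum_prod_type, Equiv.prodComm_apply, Prod.swap_prod_mk,
      Matrix.blockDiagonal_apply, Matrix.kroneckerMap_apply, Matrix.one_apply]
    simp [mul_comm]
  rw [hfactor, Matrix.det_mul, Matrix.det_submatrix_equiv_self, Matrix.det_blockDiagonal,
    Matrix.det_kronecker, norm_mul, norm_mul, norm_pow, norm_det_dftMatrix]
  simp [norm_prod, Matrix.det_nonsing_inv]

theorem norm_preconditioner_sq_le {b : ℝ} (hb : ∀ z ∈ sphere (0 : ℂ) 1, ‖(γ z)⁻¹‖ ^ 2 ≤ b)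
    (N : ℕ) : ‖preconditioner γ N‖ ^ 2 ≤ (N + 1) * b := by
  have hrow (j : Fin (N + 1)) :
      ∑ i, ∑ q : Fin (N + 1) × Fin n, ‖preconditioner γ N (j, i) q‖ ^ 2 ≤ b := by
    refine le_trans (le_of_eq ?_) (hb _ (circleNode_mem_sphere N j))
    simp only [preconditioner, Matrix.of_apply, norm_mul, mul_pow, norm_dftMatrix_apply_sq,
      Fintype.sum_prod_type, sum_const, card_univ, Fintype.card_fin, ← mul_sum, nsmul_eq_mul,
      frobenius_norm_sq]
    push_cast
    field_simp
  calc ‖preconditioner γ N‖ ^ 2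
      = ∑ j : Fin (N + 1), ∑ i, ∑ q : Fin (N + 1) × Fin n, ‖preconditioner γ N (j, i) q‖ ^ 2 := by
        rw [frobenius_norm_sq, Fintype.sum_prod_type]
    _ ≤ ∑ _j : Fin (N + 1), b := sum_le_sum fun j _ => hrow j
    _ = (N + 1) * b := by simp

theorem blockPoly_preconditioner (γ : ℂ → Matrix (Fin n) (Fin n) ℂ) (N : ℕ) (j : Fin (N + 1))
    (i : Fin n) (z : ℂ) :
    blockPoly (preconditioner γ N (j, i)) z =
      ((√(N + 1 : ℝ) : ℂ)⁻¹ * dirichletKernel N (circleNode N j) z) •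
        (γ (circleNode N j))⁻¹ i := by
  ext l
  simp only [blockPoly, preconditioner, dftMatrix, dirichletKernel, Matrix.of_apply, Pi.smul_apply,
    smul_eq_mul, mul_sum, sum_mul]
  exact sum_congr rfl fun p _ => by ring

theorem sum_norm_preconditioner_vecMul_toeplitzMatrix_sq_le (hγ : ContinuousOn γ (sphere 0 1))
    {a K : ℝ} (hK : 0 ≤ K) {N : ℕ} {j : Fin (N + 1)} (hloc : ∀ z ∈ sphere (0 : ℂ) 1,
      ‖(γ (circleNode N j))⁻¹ * γ z‖ ^ 2 ≤ a + K * ‖z - circleNode N j‖ ^ 2) :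
    ∑ i, ‖toLp 2 (preconditioner γ N (j, i) ᵥ* toeplitzMatrix γ N)‖ ^ 2 ≤
      (N + 1 : ℝ)⁻¹ * ((N + 1) * a + 4 * K) := by
  have hN : (0 : ℝ) ≤ N + 1 := by positivity
  set symbol : Fin n → ℂ → ℝ := fun i z =>
    ‖toLp 2 (blockPoly (preconditioner γ N (j, i)) z ᵥ* γ z - 0)‖ ^ 2 with hsymbol
  have hint (i) : CircleIntegrable (symbol i) 0 1 := by
    simp only [hsymbol, sub_zero]
    exact (((PiLp.continuous_toLp 2 _).comp_continuousOn
      (continuousOn_blockPoly_vecMul hγ _)).norm.pow 2).circleIntegrable zero_le_one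
  have hsum (z : ℂ) : ∑ i, symbol i z = (N + 1 : ℝ)⁻¹ *
      (‖dirichletKernel N (circleNode N j) z‖ ^ 2 * ‖(γ (circleNode N j))⁻¹ * γ z‖ ^ 2) := by
    simp only [hsymbol, frobenius_norm_sq_eq_sum_row, Matrix.mul_apply_eq_vecMul, mul_sum, sub_zero,
      blockPoly_preconditioner, Matrix.smul_vecMul, toLp_smul, norm_smul, norm_mul, norm_inv,
      Complex.norm_real, mul_pow, inv_pow, norm_of_nonneg (sqrt_nonneg _), sq_sqrt hN, mul_assoc]
  calc ∑ i, ‖toLp 2 (preconditioner γ N (j, i) ᵥ* toeplitzMatrix γ N)‖ ^ 2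
      ≤ ∑ i, circleAverage (symbol i) 0 1 :=
        sum_le_sum fun i _ => norm_vecMul_toeplitzMatrix_sq_le hγ _ continuousOn_const
          fun l q => by simp [circleCoeff, circleAverage_const]
    _ = (N + 1 : ℝ)⁻¹ * circleAverage (fun z => ‖dirichletKernel N (circleNode N j) z‖ ^ 2 *
          ‖(γ (circleNode N j))⁻¹ * γ z‖ ^ 2) 0 1 := by
        rw [← circleAverage_fun_sum fun i _ => hint i]
        simp only [hsum]
        exact circleAverage_fun_smul (a := (N + 1 : ℝ)⁻¹)
    _ ≤ (N + 1 : ℝ)⁻¹ * ((N + 1) * a + 4 * K) := by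
        gcongr
        exact circleAverage_norm_dirichletKernel_sq_mul_le (circleNode_mem_sphere N j)
          ((continuousOn_const.mul hγ).norm.pow 2) hK hloc

theorem norm_preconditioner_mul_toeplitzMatrix_sq_le (hγ : ContinuousOn γ (sphere 0 1)) {a K : ℝ}
    (hK : 0 ≤ K) (hloc : ∀ ζ ∈ sphere (0 : ℂ) 1, ∀ z ∈ sphere (0 : ℂ) 1,
      ‖(γ ζ)⁻¹ * γ z‖ ^ 2 ≤ a + K * ‖z - ζ‖ ^ 2) (N : ℕ) :
    ‖preconditioner γ N * toeplitzMatrix γ N‖ ^ 2 ≤ (N + 1) * a + 4 * K := by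
  calc ‖preconditioner γ N * toeplitzMatrix γ N‖ ^ 2
      = ∑ j, ∑ i, ‖toLp 2 (preconditioner γ N (j, i) ᵥ* toeplitzMatrix γ N)‖ ^ 2 := by
        simp only [frobenius_norm_sq_eq_sum_row, Fintype.sum_prod_type, Matrix.mul_apply_eq_vecMul]
    _ ≤ ∑ _j : Fin (N + 1), (N + 1 : ℝ)⁻¹ * ((N + 1) * a + 4 * K) :=
        sum_le_sum fun j _ => sum_norm_preconditioner_vecMul_toeplitzMatrix_sq_le hγ hK
          (hloc _ (circleNode_mem_sphere N j))
    _ = (N + 1) * a + 4 * K := by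
        rw [sum_const, card_univ, Fintype.card_fin, nsmul_eq_mul, Nat.cast_succ,
          mul_inv_cancel_left₀ N.cast_add_one_ne_zero]

theorem continuousOn_matrix_inv {X : Type*} [TopologicalSpace X] {s : Set X}
    {γ : X → Matrix (Fin n) (Fin n) ℂ} (hγ : ContinuousOn γ s) (hinv : ∀ z ∈ s, IsUnit (γ z)) :
    ContinuousOn (fun z => (γ z)⁻¹) s := by
  have hdet : ContinuousOn (fun z => (γ z).det) s :=
    continuous_id.matrix_det.comp_continuousOn hγ
  have hadj : ContinuousOn (fun z => (γ z).adjugate) s :=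
    continuous_id.matrix_adjugate.comp_continuousOn hγ
  simp only [Matrix.inv_def, Ring.inverse_eq_inv']
  exact (hdet.inv₀ fun z hz => ((Matrix.isUnit_iff_isUnit_det _).1 (hinv z hz)).ne_zero).smul hadj

theorem exists_norm_inv_mul_sq_le {s : Set ℂ} (hs : IsCompact s) (hγ : ContinuousOn γ s)
    (hinv : ∀ z ∈ s, IsUnit (γ z)) {η : ℝ} (hη : 0 < η) :
    ∃ K, 0 ≤ K ∧ ∀ ζ ∈ s, ∀ z ∈ s, ‖(γ ζ)⁻¹ * γ z‖ ^ 2 ≤ n + η + K * ‖z - ζ‖ ^ 2 := by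
  have hcont : ContinuousOn (Function.uncurry fun ζ z => ‖(γ ζ)⁻¹ * γ z‖ ^ 2) (s ×ˢ s) :=
    (((continuousOn_matrix_inv hγ hinv).comp continuousOn_fst fun w hw => hw.1).mul
      (hγ.comp continuousOn_snd fun w hw => hw.2)).norm.pow 2
  have hdiag (ζ) (hζ : ζ ∈ s) : ‖(γ ζ)⁻¹ * γ ζ‖ ^ 2 = n := by
    rw [Matrix.nonsing_inv_mul _ ((Matrix.isUnit_iff_isUnit_det _).1 (hinv ζ hζ)),
      frobenius_norm_sq]
    simp [Matrix.one_apply, apply_ite norm]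
  obtain ⟨K, hK, hle⟩ := exists_le_add_mul_dist_sq hs hcont hη
  exact ⟨K, hK, fun ζ hζ z hz => by
    simpa only [hdiag ζ hζ, dist_eq_norm] using hle ζ hζ z hz⟩

end Preconditioner

section DeterminantBound

variable {n : ℕ} {γ : ℂ → Matrix (Fin n) (Fin n) ℂ}

theorem eventually_sqrt_add_sq_le {a a' : ℝ} (ha : 0 ≤ a) (haa' : a < a') (b c : ℝ) :
    ∀ᶠ N : ℕ in atTop, (√((N + 1) * a + c) + b) ^ 2 ≤ (N + 1) * a' := by
  have hinv := tendsto_one_div_add_atTop_nhds_zero_nat (𝕜 := ℝ)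
  have hlim : Tendsto (fun N : ℕ => (√(a + c * (1 / (N + 1))) + b * √(1 / ((N : ℝ) + 1))) ^ 2)
      atTop (𝓝 a) := by
    simpa [sq_sqrt ha] using
      (((hinv.const_mul c).const_add a).sqrt.add (hinv.sqrt.const_mul b)).pow 2
  filter_upwards [hlim.eventually_le_const haa'] with N hN
  have hN0 : (0 : ℝ) < N + 1 := by positivity
  calc (√((N + 1) * a + c) + b) ^ 2
      = (√(N + 1) * (√(a + c * (1 / (N + 1))) + b * √(1 / ((N : ℝ) + 1)))) ^ 2 := by
        rw [mul_add, ← sqrt_mul hN0.le, mul_left_comm, ← sqrt_mul hN0.le,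
          mul_one_div_cancel hN0.ne', sqrt_one, mul_one, mul_add, mul_left_comm _ c,
          mul_one_div_cancel hN0.ne', mul_one]
    _ = (N + 1) * (√(a + c * (1 / (N + 1))) + b * √(1 / ((N : ℝ) + 1))) ^ 2 := by
        rw [mul_pow, sq_sqrt hN0.le]
    _ ≤ (N + 1) * a' := by gcongr

theorem eventually_mul_norm_toeplitzDet_le (hγ : ContinuousOn γ (sphere 0 1))
    (hinv : ∀ z ∈ sphere (0 : ℂ) 1, IsUnit (γ z)) {η : ℝ} (hη : 0 < η) :
    ∀ᶠ N : ℕ in atTop, ∀ (x : Fin (N + 1) × Fin n → ℂ) (k : Fin (N + 1) × Fin n) (ε : ℝ), 0 < ε →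
      ‖toLp 2 (x ᵥ* toeplitzMatrix γ N)‖ ≤ ε →
      ‖x k‖ * ‖toeplitzDet γ N‖ ≤ ε * √(N + 1) * exp ((N + 1) * η) *
        ∏ j : Fin (N + 1), ‖(γ (circleNode N j)).det‖ := by
  have hcircle := isCompact_sphere (0 : ℂ) 1
  obtain ⟨K, hK, hloc⟩ := exists_norm_inv_mul_sq_le hcircle hγ hinv hη
  obtain ⟨b, hb⟩ := hcircle.exists_bound_of_continuousOn (continuousOn_matrix_inv hγ hinv)
  have hb0 : 0 ≤ b := (norm_nonneg _).trans (hb 1 (by simp))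
  filter_upwards [eventually_sqrt_add_sq_le (by positivity) (by linarith : (n : ℝ) + η < n + 2 * η)
    b (4 * K)] with N hN x k ε hε hx
  set S := preconditioner γ N
  set P := ∏ j : Fin (N + 1), ‖(γ (circleNode N j)).det‖
  have hP : 0 < P := prod_pos fun j _ => norm_pos_iff.2
    ((Matrix.isUnit_iff_isUnit_det _).1 (hinv _ (circleNode_mem_sphere N j))).ne_zero
  set w : ℝ := √(N + 1)
  have hw : 0 < w := by positivity
  have hSA : ‖S * toeplitzMatrix γ N‖ ≤ √((N + 1) * (n + η) + 4 * K) :=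
    le_sqrt_of_sq_le (norm_preconditioner_mul_toeplitzMatrix_sq_le hγ hK hloc N)
  have hS : ‖S‖ ≤ w * b := by
    refine (le_sqrt_of_sq_le (norm_preconditioner_sq_le (b := b ^ 2)
      (fun z hz => by gcongr; exact hb z hz) N)).trans_eq ?_
    rw [sqrt_mul (by positivity), sqrt_sq hb0]
  have hpert : (ε * w)⁻¹ * ‖S‖ * ‖toLp 2 (x ᵥ* toeplitzMatrix γ N)‖ ≤ b := by
    calc _ ≤ (ε * w)⁻¹ * (w * b) * ε := by gcongr
      _ = b := by field_simp
  have hdet : ‖(S * toeplitzMatrix γ N).det‖ = P⁻¹ * ‖toeplitzDet γ N‖ := by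
    rw [Matrix.det_mul, norm_mul, norm_det_preconditioner, prod_inv_distrib, toeplitzDet]
  calc ‖x k‖ * ‖toeplitzDet γ N‖
      = ε * w * P * ((ε * w)⁻¹ * ‖x k‖ * ‖(S * toeplitzMatrix γ N).det‖) := by
        rw [hdet]; field_simp
    _ ≤ ε * w * P * exp (((√((N + 1) * (n + η) + 4 * K) + b) ^ 2 - (N + 1) * n) / 2) := by
        gcongr
        refine (mul_norm_mul_norm_det_mul_le S _ x k (by positivity)).trans ?_
        rw [Fintype.card_prod, Fintype.card_fin, Fintype.card_fin, Nat.cast_mul, Nat.cast_succ]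
        gcongr
    _ ≤ ε * w * P * exp ((N + 1) * η) := by gcongr; linarith
    _ = ε * w * exp ((N + 1) * η) * P := by ring

end DeterminantBound

section RiemannSums

variable {E : Type*} [NormedAddCommGroup E] [NormedSpace ℝ E] [CompleteSpace E]

theorem norm_sum_smul_sub_integral_le {F : ℝ → E} {t : ℕ → ℝ} (ht : Monotone t) {m : ℕ} {η : ℝ}
    (hF : ContinuousOn F (Set.Icc (t 0) (t m)))
    (hosc : ∀ j < m, ∀ θ ∈ Set.Icc (t j) (t (j + 1)), ‖F (t j) - F θ‖ ≤ η) :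
    ‖∑ j ∈ range m, (t (j + 1) - t j) • F (t j) - ∫ θ in t 0..t m, F θ‖ ≤ η * (t m - t 0) := by
  have hint (j) (hj : j < m) : IntervalIntegrable F volume (t j) (t (j + 1)) :=
    (hF.mono (Set.Icc_subset_Icc (ht j.zero_le) (ht hj))).intervalIntegrable_of_Icc
      (ht j.le_succ)
  have hcell (j) (hj : j < m) :
      ‖(t (j + 1) - t j) • F (t j) - ∫ θ in t j..t (j + 1), F θ‖ ≤ η * (t (j + 1) - t j) := by
    rw [← intervalIntegral.integral_const, ← intervalIntegral.integral_sub
      intervalIntegrable_const (hint j hj)]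
    refine (intervalIntegral.norm_integral_le_of_norm_le_const fun θ hθ => hosc j hj θ ?_).trans_eq
      (by rw [abs_of_nonneg (sub_nonneg.2 (ht j.le_succ))])
    rw [Set.uIoc_of_le (ht j.le_succ)] at hθ
    exact Set.Ioc_subset_Icc_self hθ
  rw [← intervalIntegral.sum_integral_adjacent_intervals hint, ← sum_sub_distrib]
  calc ‖∑ j ∈ range m, ((t (j + 1) - t j) • F (t j) - ∫ θ in t j..t (j + 1), F θ)‖
      ≤ ∑ j ∈ range m, η * (t (j + 1) - t j) :=
        norm_sum_le_of_le _ fun j hj => hcell j (mem_range.1 hj)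
    _ = η * (t m - t 0) := by rw [← mul_sum, sum_range_sub]

theorem tendsto_average_circleNode {f : ℂ → E} (hf : ContinuousOn f (sphere 0 1)) :
    Tendsto (fun N : ℕ => (N + 1 : ℝ)⁻¹ • ∑ j : Fin (N + 1), f (circleNode N j)) atTop
      (𝓝 (circleAverage f 0 1)) := by
  have hF : Continuous fun θ => f (circleMap 0 1 θ) :=
    hf.comp_continuous (continuous_circleMap 0 1) (circleMap_mem_sphere 0 zero_le_one)
  refine Metric.tendsto_nhds.2 fun η hη => ?_
  obtain ⟨δ, hδ, hunif⟩ := uniformContinuousOn_iff.1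
    (isCompact_Icc.uniformContinuousOn_of_continuous (hF.continuousOn (s := Set.Icc 0 (2 * π))))
    (η / 2) (by positivity)
  have hmesh : Tendsto (fun N : ℕ => 2 * π * (1 / ((N : ℝ) + 1))) atTop (𝓝 0) := by
    simpa using tendsto_one_div_add_atTop_nhds_zero_nat.const_mul (2 * π)
  filter_upwards [hmesh.eventually_lt_const hδ] with N hN
  set t : ℕ → ℝ := fun j => 2 * π * j / (N + 1) with ht
  have htmono : Monotone t := fun i j hij => by simp only [ht]; gcongr
  have hstep (j : ℕ) : t (j + 1) - t j = 2 * π * (1 / (N + 1)) := by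
    simp only [ht]; push_cast; ring
  have ht0 : t 0 = 0 := by simp [ht]
  have htN : t (N + 1) = 2 * π := by simp only [ht]; push_cast; field_simp
  have hosc (j) (hj : j < N + 1) (θ) (hθ : θ ∈ Set.Icc (t j) (t (j + 1))) :
      ‖f (circleMap 0 1 (t j)) - f (circleMap 0 1 θ)‖ ≤ η / 2 := by
    have hlo : 0 ≤ t j := ht0 ▸ htmono j.zero_le
    have hhi : t (j + 1) ≤ 2 * π := htN ▸ htmono hj
    rw [← dist_eq_norm]
    refine (hunif _ ⟨hlo, hθ.1.trans (hθ.2.trans hhi)⟩ _ ⟨hlo.trans hθ.1, hθ.2.trans hhi⟩ ?_).le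
    rw [dist_comm, Real.dist_eq, abs_of_nonneg (sub_nonneg.2 hθ.1)]
    linarith [hθ.2, hstep j]
  have hsum := norm_sum_smul_sub_integral_le htmono hF.continuousOn hosc
  simp only [hstep, ht0, htN, sub_zero, ← smul_sum] at hsum
  have hrescale : (N + 1 : ℝ)⁻¹ • ∑ j : Fin (N + 1), f (circleNode N j) - circleAverage f 0 1 =
      (2 * π)⁻¹ • ((2 * π * (1 / ((N : ℝ) + 1))) • ∑ j ∈ range (N + 1), f (circleMap 0 1 (t j)) -
        ∫ θ in 0..2 * π, f (circleMap 0 1 θ)) := by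
    rw [smul_sub, smul_smul, inv_mul_cancel_left₀ two_pi_pos.ne', one_div, circleAverage_def,
      ← Fin.sum_univ_eq_sum_range (fun j => f (circleMap 0 1 (t j)))]
    rfl
  rw [dist_eq_norm, hrescale, norm_smul, norm_of_nonneg (by positivity),
    inv_mul_lt_iff₀ two_pi_pos]
  nlinarith [two_pi_pos]

end RiemannSums

section GeometricMean

variable {n : ℕ} {γ : ℂ → Matrix (Fin n) (Fin n) ℂ}

theorem exists_isLogDetBranch (hγ : ContinuousOn γ (sphere 0 1))
    (hinv : ∀ z ∈ sphere (0 : ℂ) 1, IsUnit (γ z)) : ∃ ℓ, IsLogDetBranch γ ℓ := by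
  have hdet : Continuous fun θ : ℝ => (γ (circleMap 0 1 θ)).det :=
    (hγ.comp_continuous (continuous_circleMap 0 1)
      (circleMap_mem_sphere 0 zero_le_one)).matrix_det
  obtain ⟨ℓ, hℓ, hexp⟩ := Complex.exists_continuousOn_eqOn_exp_comp (U := Set.univ (α := ℝ))
    (Homeomorph.Set.univ ℝ).toHomotopyEquiv.simplyConnectedSpace isOpen_univ hdet.continuousOn (by
      rintro ⟨θ, -, hθ⟩
      exact ((Matrix.isUnit_iff_isUnit_det _).1
        (hinv _ (circleMap_mem_sphere 0 zero_le_one θ))).ne_zero hθ)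
  refine ⟨ℓ, hℓ.mono (Set.subset_univ _), fun θ _ => ?_⟩
  simpa [circleMap] using hexp (Set.mem_univ θ)

theorem norm_geometricMean (hγ : ContinuousOn γ (sphere 0 1))
    (hinv : ∀ z ∈ sphere (0 : ℂ) 1, IsUnit (γ z)) :
    ‖geometricMean γ‖ = exp (circleAverage (fun z => log ‖(γ z).det‖) 0 1) := by
  obtain ⟨ℓ, hℓ⟩ := exists_isLogDetBranch hγ hinv
  have hint : IntervalIntegrable ℓ volume 0 (2 * π) :=
    hℓ.1.intervalIntegrable_of_Icc two_pi_pos.le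
  have hre : (∫ θ in (0 : ℝ)..(2 * π), ℓ θ).re =
      ∫ θ in (0 : ℝ)..(2 * π), log ‖(γ (circleMap 0 1 θ)).det‖ := by
    refine (Complex.reCLM.intervalIntegral_comp_comm hint).symm.trans
      (intervalIntegral.integral_congr fun θ hθ => ?_)
    rw [Set.uIcc_of_le two_pi_pos.le] at hθ
    simp only [circleMap_zero, Complex.ofReal_one, one_mul, ← hℓ.2 θ hθ, Complex.norm_exp, log_exp,
      Complex.reCLM_apply]
  rw [geometricMean_eq hℓ, Complex.norm_exp, circleAverage_def, ← hre]
  congr 1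
  rw [← Complex.ofReal_ofNat, ← Complex.ofReal_mul, ← Complex.ofReal_inv, Complex.re_ofReal_mul,
    smul_eq_mul]

theorem eventually_prod_norm_det_circleNode_le (hγ : ContinuousOn γ (sphere 0 1))
    (hinv : ∀ z ∈ sphere (0 : ℂ) 1, IsUnit (γ z)) {η : ℝ} (hη : 0 < η) :
    ∀ᶠ N : ℕ in atTop, ∏ j : Fin (N + 1), ‖(γ (circleNode N j)).det‖ ≤
      ‖geometricMean γ‖ ^ (N + 1) * exp ((N + 1) * η) := by
  have hpos (z) (hz : z ∈ sphere (0 : ℂ) 1) : ‖(γ z).det‖ ≠ 0 :=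
    norm_ne_zero_iff.2 ((Matrix.isUnit_iff_isUnit_det _).1 (hinv z hz)).ne_zero
  have hlog : ContinuousOn (fun z => log ‖(γ z).det‖) (sphere 0 1) :=
    (continuous_id.matrix_det.comp_continuousOn hγ).norm.log hpos
  filter_upwards [(tendsto_average_circleNode hlog).eventually_le_const
    (lt_add_of_pos_right _ hη)] with N hN
  rw [smul_eq_mul, inv_mul_le_iff₀ (by positivity)] at hN
  calc ∏ j : Fin (N + 1), ‖(γ (circleNode N j)).det‖
      = exp (∑ j : Fin (N + 1), log ‖(γ (circleNode N j)).det‖) := by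
        rw [exp_sum]
        exact prod_congr rfl fun j _ => (exp_log (by
          positivity [hpos _ (circleNode_mem_sphere N j)])).symm
    _ ≤ exp ((N + 1) * (circleAverage (fun z => log ‖(γ z).det‖) 0 1 + η)) := exp_le_exp.2 hN
    _ = ‖geometricMean γ‖ ^ (N + 1) * exp ((N + 1) * η) := by
        rw [norm_geometricMean hγ hinv, ← exp_nat_mul, ← exp_add, Nat.cast_succ, mul_add]

end GeometricMean

section ApproximateNullVectors

variable {n : ℕ} {γ : ℂ → Matrix (Fin n) (Fin n) ℂ}

/-- The first `N + 1` blocks of a sequence of blocks, as a vector on which the Toeplitz matrix of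
the same size acts. -/
def truncation (a : ℕ → Fin n → ℂ) (N : ℕ) : Fin (N + 1) × Fin n → ℂ :=
  fun p => a p.1 p.2

theorem blockPoly_truncation (a : ℕ → Fin n → ℂ) (N : ℕ) (z : ℂ) :
    blockPoly (truncation a N) z = ∑ q ∈ range (N + 1), z⁻¹ ^ q • a q := by
  ext i
  rw [Finset.sum_apply, ← Fin.sum_univ_eq_sum_range (fun q => (z⁻¹ ^ q • a q) i)]
  exact sum_congr rfl fun q _ => by
    rw [Pi.smul_apply, smul_eq_mul, mul_comm, zpow_neg, zpow_natCast, inv_pow, truncation]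

theorem tendsto_toeplitzDet_div_zero (hγ : ContinuousOn γ (sphere 0 1))
    (hinv : ∀ z ∈ sphere (0 : ℂ) 1, IsUnit (γ z)) {a : ℕ → Fin n → ℂ} {q : ℕ} {i : Fin n}
    (ha : a q i ≠ 0) {C r : ℝ} (hr0 : 0 < r) (hr1 : r < 1)
    (hnull : ∀ N, ‖toLp 2 (truncation a N ᵥ* toeplitzMatrix γ N)‖ ≤ C * r ^ N) :
    Tendsto (fun N : ℕ => toeplitzDet γ N / geometricMean γ ^ (N + 1)) atTop (𝓝 0) := by
  obtain ⟨η, hη, hηr⟩ : ∃ η, 0 < η ∧ 2 * η + log r < 0 :=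
    ⟨-log r / 4, by linarith [log_neg hr0 hr1], by linarith [log_neg hr0 hr1]⟩
  set κ := exp (2 * η + log r) with hκ
  have hκ1 : κ < 1 := exp_lt_one_iff.2 hηr
  have hG : 0 < ‖geometricMean γ‖ := norm_geometricMean hγ hinv ▸ exp_pos _
  have hlim : Tendsto (fun N : ℕ => ‖a q i‖⁻¹ * (|C| + 1) * exp (2 * η) *
      (N * κ ^ N + κ ^ N)) atTop (𝓝 0) := by
    simpa using ((tendsto_self_mul_const_pow_of_lt_one (by positivity) hκ1).add
      (tendsto_pow_atTop_nhds_zero_of_lt_one (by positivity) hκ1)).const_mul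
      (‖a q i‖⁻¹ * (|C| + 1) * exp (2 * η))
  refine squeeze_zero_norm' ?_ hlim
  filter_upwards [eventually_mul_norm_toeplitzDet_le hγ hinv hη,
    eventually_prod_norm_det_circleNode_le hγ hinv hη, eventually_ge_atTop q] with N hdet hprod hN
  have hdet := hdet (truncation a N) (⟨q, Nat.lt_succ_of_le hN⟩, i) ((|C| + 1) * r ^ N)
    (by positivity) ((hnull N).trans (by gcongr; linarith [le_abs_self C]))
  have hsqrt : √((N : ℝ) + 1) ≤ N + 1 := sqrt_le_self_iff.2 (.inr (by simp))
  rw [norm_div, norm_pow, div_le_iff₀ (by positivity), mul_assoc, mul_assoc, mul_assoc,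
    le_inv_mul_iff₀ (norm_pos_iff.2 ha)]
  calc ‖a q i‖ * ‖toeplitzDet γ N‖
      ≤ (|C| + 1) * r ^ N * (N + 1) * exp ((N + 1) * η) *
          (‖geometricMean γ‖ ^ (N + 1) * exp ((N + 1) * η)) := hdet.trans (by gcongr)
    _ = (|C| + 1) * (exp (2 * η) * ((N * κ ^ N + κ ^ N) * ‖geometricMean γ‖ ^ (N + 1))) := by
        have hκN : κ ^ N = exp (N * (2 * η)) * r ^ N := by
          rw [hκ, exp_add, exp_log hr0, mul_pow, ← exp_nat_mul]
        have hexp : exp ((N + 1) * η) * exp ((N + 1) * η) = exp (2 * η) * exp (N * (2 * η)) := by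
          rw [← exp_add, ← exp_add]
          ring_nf
        rw [hκN]
        linear_combination
          (|C| + 1) * r ^ N * (N + 1) * ‖geometricMean γ‖ ^ (N + 1) * hexp

end ApproximateNullVectors

section AnalyticFunctions

variable {E : Type*} [NormedAddCommGroup E] [NormedSpace ℂ E]

theorem diffContOnCl_pi {ι : Type*} [Fintype ι] {f : ℂ → ι → ℂ} {s : Set ℂ} :
    DiffContOnCl ℂ f s ↔ ∀ i, DiffContOnCl ℂ (fun z => f z i) s :=
  ⟨fun h i => ⟨differentiableOn_pi.1 h.1 i, continuousOn_pi.1 h.2 i⟩,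
    fun h => ⟨differentiableOn_pi.2 fun i => (h i).1, continuousOn_pi.2 fun i => (h i).2⟩⟩

theorem exists_norm_circleCoeff_neg_le {f : ℂ → E} {r : ℝ} (hr0 : 0 < r) (hr1 : r < 1)
    (hc : ContinuousOn f (closedBall 0 1 \ ball 0 r))
    (hd : DifferentiableOn ℂ f (ball 0 1 \ closedBall 0 r)) :
    ∃ B : ℝ, ∀ k : ℕ, ‖circleCoeff f (-k)‖ ≤ B * r ^ k := by
  obtain ⟨B, hB⟩ := (isCompact_sphere (0 : ℂ) r).exists_bound_of_continuousOn
    (hc.mono fun z hz => ⟨by simp [mem_sphere_zero_iff_norm.1 hz, hr1.le],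
      by simp [mem_sphere_zero_iff_norm.1 hz]⟩)
  refine ⟨B, fun k => ?_⟩
  have hshift : circleCoeff f (-k) = circleAverage (fun z => z ^ k • f z) 0 r := by
    rw [circleCoeff, circleAverage_eq_circleIntegral one_ne_zero,
      circleAverage_eq_circleIntegral hr0.ne']
    simp only [neg_neg, zpow_natCast]
    congr 1
    refine Complex.circleIntegral_sub_center_inv_smul_eq_of_differentiable_on_annulus_off_countable
      hr0 hr1.le Set.countable_empty ((continuousOn_pow k).smul hc) fun z hz => ?_
    exact (differentiableAt_pow k).smul
      (hd.differentiableAt ((isOpen_ball.sdiff isClosed_closedBall).mem_nhds hz.1))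
  rw [hshift]
  refine norm_circleAverage_le hr0.le fun z hz => ?_
  rw [norm_smul, norm_pow, mem_sphere_zero_iff_norm.1 hz, mul_comm]
  gcongr
  exact hB z hz

theorem exists_annulus_subset_of_isOpen {U : Set ℂ} (hU : IsOpen U) (hsub : sphere 0 1 ⊆ U) :
    ∃ r : ℝ, 0 < r ∧ r < 1 ∧ closedBall 0 1 \ ball 0 r ⊆ U := by
  obtain ⟨δ, hδ, hδU⟩ := (isCompact_sphere (0 : ℂ) 1).exists_cthickening_subset_open hU hsub
  refine ⟨max (1 - δ) (1 / 2), by positivity, max_lt (by linarith) (by norm_num), fun z hz => ?_⟩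
  simp only [Set.mem_sdiff, mem_closedBall_zero_iff, mem_ball_zero_iff, not_lt, max_le_iff] at hz
  obtain ⟨hz1, hzδ, hz2⟩ := hz
  have hz0 : 0 < ‖z‖ := by linarith
  refine hδU (mem_cthickening_of_dist_le z ((‖z‖⁻¹ : ℝ) * z) δ _ (by simp [hz0.ne']) ?_)
  have hdist : z - ((‖z‖⁻¹ : ℝ) : ℂ) * z = ((1 - ‖z‖⁻¹ : ℝ) : ℂ) * z := by push_cast; ring
  rw [dist_eq_norm, hdist, norm_mul, Complex.norm_real, norm_eq_abs, abs_sub_comm,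
    abs_of_nonneg (sub_nonneg.2 ((one_le_inv₀ hz0).2 hz1)), sub_mul, inv_mul_cancel₀ hz0.ne']
  linarith

theorem analyticAt_matrix_iff {ι κ : Type*} [Fintype ι] [Fintype κ] {A : ℂ → Matrix ι κ ℂ}
    {z : ℂ} : AnalyticAt ℂ A z ↔ ∀ i j, AnalyticAt ℂ (fun w => A w i j) z := by
  classical
  refine ⟨fun h i j => ?_, fun h => ?_⟩
  · exact ((Matrix.entryLinearMap ℂ ℂ i j).toContinuousLinearMap.analyticAt _).comp h
  · rw [show A = fun w => ∑ i, ∑ j, A w i j • Matrix.single i j (1 : ℂ) by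
      funext w; simpa using Matrix.matrix_eq_sum_single (A w)]
    exact analyticAt_fun_sum _ fun i _ => analyticAt_fun_sum _ fun j _ =>
      (h i j).smul analyticAt_const

theorem analyticAt_matrix_inv {ι : Type*} [Fintype ι] [DecidableEq ι] {A : ℂ → Matrix ι ι ℂ}
    {z : ℂ} (hA : AnalyticAt ℂ A z) (hinv : IsUnit (A z)) :
    AnalyticAt ℂ (fun w => (A w)⁻¹) z := by
  simp only [Matrix.nonsing_inv_eq_ringInverse]
  obtain ⟨u, hu⟩ := hinv
  exact AnalyticAt.comp (hu ▸ analyticAt_inverse u) hA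

variable [CompleteSpace E]

theorem diffContOnCl_update_comp_inv {f : ℂ → E} {c : E} (hf : DiffContOnCl ℂ f (closedBall 0 1)ᶜ)
    (hc : Tendsto f (cocompact ℂ) (𝓝 c)) :
    DiffContOnCl ℂ (Function.update (fun w => f w⁻¹) 0 c) (ball 0 1) := by
  have hmaps : Set.MapsTo (fun w : ℂ => w⁻¹) (closedBall 0 1 \ {0})
      (closure (closedBall 0 1)ᶜ) := by
    intro w hw
    rw [closure_compl, interior_closedBall _ one_ne_zero]
    simpa using (one_le_inv₀ (norm_pos_iff.2 hw.2)).2 (mem_closedBall_zero_iff.1 hw.1)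
  have hcont : ContinuousOn (Function.update (fun w => f w⁻¹) 0 c) (closedBall 0 1) := by
    refine continuousOn_update_iff.2 ⟨hf.continuousOn.comp
      (continuousOn_inv₀.mono fun w hw => hw.2) hmaps, fun _ => hc.comp ?_⟩
    rw [← cobounded_eq_cocompact]
    exact tendsto_inv₀_nhdsNE_zero.mono_left (nhdsWithin_mono _ fun w hw => hw.2)
  have hdiff : DifferentiableOn ℂ (Function.update (fun w => f w⁻¹) 0 c) (ball 0 1 \ {0}) := by
    refine (hf.differentiableOn.comp (differentiableOn_inv.mono fun w hw => hw.2) ?_).congr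
      fun w hw => Function.update_of_ne hw.2 _ _
    intro w hw
    simpa using (one_lt_inv₀ (norm_pos_iff.2 hw.2)).2 (mem_ball_zero_iff.1 hw.1)
  exact ⟨(Complex.differentiableOn_compl_singleton_and_continuousAt_iff
    (ball_mem_nhds 0 one_pos)).1 ⟨hdiff, hcont.continuousAt (closedBall_mem_nhds 0 one_pos)⟩,
    (closure_ball (0 : ℂ) one_ne_zero).symm ▸ hcont⟩

theorem hasSum_pow_smul_circleCoeff {f : ℂ → E} (hf : DiffContOnCl ℂ f (ball 0 1)) {w : ℂ}
    (hw : w ∈ ball 0 1) : HasSum (fun k : ℕ => w ^ k • circleCoeff f k) (f w) := by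
  have hseries := (DiffContOnCl.hasFPowerSeriesOnBall (R := 1) (by simpa using hf)
    zero_lt_one).hasSum (y := w) (by
      rw [mem_eball, edist_zero_right, ENNReal.coe_one, ← ofReal_norm, ENNReal.ofReal_lt_one]
      exact mem_ball_zero_iff.1 hw)
  rw [zero_add] at hseries
  convert hseries using 2 with k
  rw [cauchyPowerSeries_apply, circleCoeff, circleAverage_eq_circleIntegral one_ne_zero,
    smul_comm, ← circleIntegral.integral_smul]
  congr 1
  refine circleIntegral.integral_congr zero_le_one fun z _ => ?_
  simp only [sub_zero, zpow_neg, zpow_natCast, div_pow, smul_smul]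
  congr 1
  ring

theorem hasSum_pow_smul_circleCoeff_of_summable {f : ℂ → E} (hf : DiffContOnCl ℂ f (ball 0 1))
    (hsum : Summable fun k : ℕ => ‖circleCoeff f k‖) {w : ℂ} (hw : w ∈ closedBall 0 1) :
    HasSum (fun k : ℕ => w ^ k • circleCoeff f k) (f w) := by
  have hle (k : ℕ) (v : ℂ) (hv : v ∈ closedBall 0 1) :
      ‖v ^ k • circleCoeff f k‖ ≤ ‖circleCoeff f k‖ := by
    rw [norm_smul, norm_pow]
    exact mul_le_of_le_one_left (norm_nonneg _)
      (pow_le_one₀ (norm_nonneg _) (mem_closedBall_zero_iff.1 hv))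
  have hcont : ContinuousOn (fun v : ℂ => ∑' k : ℕ, v ^ k • circleCoeff f k) (closedBall 0 1) :=
    continuousOn_tsum (fun k => by fun_prop) hsum hle
  have heq : Set.EqOn (fun v : ℂ => ∑' k : ℕ, v ^ k • circleCoeff f k) f (closedBall 0 1) :=
    Set.EqOn.of_subset_closure (fun v hv => (hasSum_pow_smul_circleCoeff hf hv).tsum_eq) hcont
      hf.continuousOn_ball ball_subset_closedBall (closure_ball _ one_ne_zero).ge
  rw [← heq hw]
  exact (Summable.of_norm_bounded hsum fun k => hle k w hw).hasSum

end AnalyticFunctions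

section HomogeneousProblem

variable {n m : ℕ} {γ : ℂ → Matrix (Fin n) (Fin n) ℂ} {F g : ℂ → Fin n → ℂ}

/-- A solution `(φ₊, φ₋)` of the Riemann–Hilbert problem with one column and `φ₋(∞) = 0`, where the
function `φ₋` on the outside of the circle is encoded by `g w = φ₋ (1 / w)` on the unit disc. -/
structure IsHomogeneousSolution (γ : ℂ → Matrix (Fin n) (Fin n) ℂ) (F g : ℂ → Fin n → ℂ) :
    Prop where
  inside : DiffContOnCl ℂ F (ball 0 1)
  outside : DiffContOnCl ℂ g (ball 0 1)
  jump : ∀ z ∈ sphere (0 : ℂ) 1, F z = g z⁻¹ ᵥ* γ z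
  at_infinity : g 0 = 0

theorem continuousOn_of_analyticOnNhd
    (hγ : ∀ i j, AnalyticOnNhd ℂ (fun z => γ z i j) (sphere 0 1)) :
    ContinuousOn γ (sphere 0 1) :=
  continuousOn_pi.2 fun i => continuousOn_pi.2 fun j => (hγ i j).continuousOn

theorem exists_annulus_analyticAt_inv
    (hγ : ∀ i j, AnalyticOnNhd ℂ (fun z => γ z i j) (sphere 0 1))
    (hinv : ∀ z ∈ sphere (0 : ℂ) 1, IsUnit (γ z)) :
    ∃ r : ℝ, 0 < r ∧ r < 1 ∧
      ∀ z ∈ closedBall 0 1 \ ball 0 r, ∀ i j, AnalyticAt ℂ (fun w => (γ w)⁻¹ i j) z := by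
  obtain ⟨r, hr0, hr1, hr⟩ := exists_annulus_subset_of_isOpen
    (isOpen_analyticAt ℂ fun z => (γ z)⁻¹) fun z hz =>
      analyticAt_matrix_inv (analyticAt_matrix_iff.2 fun i j => hγ i j z hz) (hinv z hz)
  exact ⟨r, hr0, hr1, fun z hz => analyticAt_matrix_iff.1 (hr hz)⟩

theorem IsHomogeneousSolution.circleCoeff_outside (h : IsHomogeneousSolution γ F g)
    (hinv : ∀ z ∈ sphere (0 : ℂ) 1, IsUnit (γ z)) (k : ℤ) :
    circleCoeff g k = circleCoeff (fun z => F z ᵥ* (γ z)⁻¹) (-k) := by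
  rw [← neg_neg k, ← circleCoeff_comp_inv, neg_neg]
  refine circleCoeff_congr (fun z hz => ?_) (-k)
  simp only [h.jump z hz, Matrix.vecMul_vecMul]
  rw [Matrix.mul_nonsing_inv _ ((Matrix.isUnit_iff_isUnit_det _).1 (hinv z hz)),
    Matrix.vecMul_one]

/-- `F γ⁻¹` continues `φ₋` analytically into an annulus inside the unit circle. -/
theorem IsHomogeneousSolution.exists_norm_circleCoeff_le (h : IsHomogeneousSolution γ F g)
    (hγ : ∀ i j, AnalyticOnNhd ℂ (fun z => γ z i j) (sphere 0 1))
    (hinv : ∀ z ∈ sphere (0 : ℂ) 1, IsUnit (γ z)) :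
    ∃ B r : ℝ, 0 < r ∧ r < 1 ∧ ∀ k : ℕ, ‖circleCoeff g k‖ ≤ B * r ^ k := by
  obtain ⟨r, hr0, hr1, hr⟩ := exists_annulus_analyticAt_inv hγ hinv
  have hcont : ContinuousOn (fun z => F z ᵥ* (γ z)⁻¹) (closedBall 0 1 \ ball 0 r) :=
    continuousOn_pi.2 fun j => continuousOn_finsetSum univ fun i _ =>
      ContinuousOn.fun_mul ((continuousOn_pi.1 h.inside.continuousOn_ball i).mono Set.sdiff_subset)
        fun z hz => (hr z hz i j).continuousAt.continuousWithinAt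
  have hdiff : DifferentiableOn ℂ (fun z => F z ᵥ* (γ z)⁻¹) (ball 0 1 \ closedBall 0 r) :=
    differentiableOn_pi.2 fun j => DifferentiableOn.fun_sum (u := univ) fun i _ =>
      ((differentiableOn_pi.1 h.inside.differentiableOn i).mono Set.sdiff_subset).fun_mul
        fun z hz => (hr z ⟨ball_subset_closedBall hz.1, fun hz' => hz.2
          (ball_subset_closedBall hz')⟩ i j).differentiableAt.differentiableWithinAt
  obtain ⟨B, hB⟩ := exists_norm_circleCoeff_neg_le hr0 hr1 hcont hdiff
  exact ⟨B, r, hr0, hr1, fun k => h.circleCoeff_outside hinv k ▸ hB k⟩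

theorem IsHomogeneousSolution.circleCoeff_zero (h : IsHomogeneousSolution γ F g) :
    circleCoeff g 0 = 0 := by
  simpa using circleCoeff_neg_natCast_eq_zero h.outside h.at_infinity 0

theorem IsHomogeneousSolution.hasSum_inv_pow_smul (h : IsHomogeneousSolution γ F g)
    (hsum : Summable fun k : ℕ => ‖circleCoeff g k‖) {z : ℂ} (hz : z ∈ sphere (0 : ℂ) 1) :
    HasSum (fun q : ℕ => z⁻¹ ^ q • circleCoeff g (q + 1 : ℕ)) (z • g z⁻¹) := by
  have hz0 := ne_zero_of_mem_unit_sphere hz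
  have hseries := hasSum_pow_smul_circleCoeff_of_summable h.outside hsum (w := z⁻¹)
    (by simp [mem_sphere_zero_iff_norm.1 hz])
  rw [← hasSum_nat_add_iff' 1, sum_range_one, Nat.cast_zero, h.circleCoeff_zero, smul_zero,
    sub_zero] at hseries
  refine (hseries.const_smul z).congr_fun fun q => ?_
  rw [smul_smul, pow_succ', mul_inv_cancel_left₀ hz0]

theorem exists_norm_toLp_le (n : ℕ) :
    ∃ K : ℝ, 0 ≤ K ∧ ∀ v : Fin n → ℂ, ‖toLp 2 v‖ ≤ K * ‖v‖ :=
  ⟨_, norm_nonneg _, ((PiLp.continuousLinearEquiv 2 ℂ fun _ : Fin n => ℂ).symm :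
    (Fin n → ℂ) →L[ℂ] PiLp 2 fun _ : Fin n => ℂ).le_opNorm⟩

theorem IsHomogeneousSolution.norm_blockPoly_truncation_sub_le
    (h : IsHomogeneousSolution γ F g) {B r : ℝ} (hr0 : 0 ≤ r) (hr1 : r < 1)
    (hB : ∀ k : ℕ, ‖circleCoeff g k‖ ≤ B * r ^ k) {z : ℂ} (hz : z ∈ sphere (0 : ℂ) 1) (N : ℕ) :
    ‖blockPoly (truncation (fun q => circleCoeff g (q + 1 : ℕ)) N) z - z • g z⁻¹‖ ≤
      B / (1 - r) * r ^ N := by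
  have hB0 : 0 ≤ B := by simpa using (norm_nonneg _).trans (hB 0)
  have : 0 < 1 - r := sub_pos.2 hr1
  have hsum : Summable fun k : ℕ => ‖circleCoeff g k‖ :=
    .of_nonneg_of_le (fun _ => norm_nonneg _) hB
      ((summable_geometric_of_lt_one hr0 hr1).mul_left B)
  have hterm (q : ℕ) : ‖z⁻¹ ^ q • circleCoeff g (q + 1 : ℕ)‖ ≤ B * r ^ q := by
    rw [norm_smul, norm_pow, norm_inv, mem_sphere_zero_iff_norm.1 hz, inv_one, one_pow, one_mul]
    exact (hB (q + 1)).trans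
      (mul_le_mul_of_nonneg_left (pow_le_pow_of_le_one hr0 hr1.le q.le_succ) hB0)
  rw [blockPoly_truncation]
  calc _ ≤ B * r ^ (N + 1) / (1 - r) :=
        norm_sub_le_of_geometric_bound_of_hasSum hr1 hterm (h.hasSum_inv_pow_smul hsum hz) (N + 1)
    _ = B / (1 - r) * r ^ (N + 1) := mul_div_right_comm _ _ _
    _ ≤ B / (1 - r) * r ^ N :=
        mul_le_mul_of_nonneg_left (pow_le_pow_of_le_one hr0 hr1.le N.le_succ) (by positivity)

/-- Comparing Fourier coefficients of `φ₊ = γᵀ φ₋`, the Taylor coefficients of `φ₋` at infinity are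
a left null vector of the infinite Toeplitz matrix; truncating it costs the tail of the series. -/
theorem IsHomogeneousSolution.exists_norm_truncation_vecMul_le
    (h : IsHomogeneousSolution γ F g) (hγ : ContinuousOn γ (sphere 0 1)) {B r : ℝ}
    (hr0 : 0 ≤ r) (hr1 : r < 1) (hB : ∀ k : ℕ, ‖circleCoeff g k‖ ≤ B * r ^ k) :
    ∃ C : ℝ, ∀ N, ‖toLp 2 (truncation (fun q => circleCoeff g (q + 1 : ℕ)) N ᵥ*
      toeplitzMatrix γ N)‖ ≤ C * r ^ N := by
  obtain ⟨K, hK0, hK⟩ := exists_norm_toLp_le n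
  obtain ⟨M, hM⟩ := (isCompact_sphere (0 : ℂ) 1).exists_bound_of_continuousOn hγ
  have hdiff : DiffContOnCl ℂ (fun z => z • F z) (ball 0 1) :=
    differentiable_id.diffContOnCl.smul h.inside
  have hcoeff (l : Fin n) (q : ℕ) : circleCoeff (fun z => (z • F z) l) (-q) = 0 :=
    circleCoeff_neg_natCast_eq_zero (diffContOnCl_pi.1 hdiff l) (by simp) q
  refine ⟨K * (B / (1 - r)) * M, fun N => ?_⟩
  set P := blockPoly (truncation (fun q => circleCoeff g (q + 1 : ℕ)) N)
  have herror (z) (hz : z ∈ sphere (0 : ℂ) 1) :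
      ‖toLp 2 (P z ᵥ* γ z - z • F z)‖ ≤ K * (B / (1 - r)) * M * r ^ N := by
    rw [h.jump z hz, ← Matrix.smul_vecMul, ← Matrix.sub_vecMul]
    calc _ ≤ ‖toLp 2 (P z - z • g z⁻¹)‖ * ‖γ z‖ := norm_vecMul_le _ _
      _ ≤ K * ‖P z - z • g z⁻¹‖ * ‖γ z‖ := by gcongr; exact hK _
      _ ≤ K * (B / (1 - r) * r ^ N) * M := by
        have hP := h.norm_blockPoly_truncation_sub_le hr0 hr1 hB hz N
        have hPnonneg := (norm_nonneg _).trans hP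
        gcongr
        exact hM z hz
      _ = _ := by ring
  refine le_of_sq_le_sq ?_ ((norm_nonneg _).trans (herror 1 (by simp)))
  calc _ ≤ circleAverage (fun z => ‖toLp 2 (P z ᵥ* γ z - z • F z)‖ ^ 2) 0 1 :=
        norm_vecMul_toeplitzMatrix_sq_le hγ _
          (hdiff.continuousOn_ball.mono sphere_subset_closedBall) hcoeff
    _ ≤ (K * (B / (1 - r)) * M * r ^ N) ^ 2 :=
        (le_norm_self _).trans (norm_circleAverage_le zero_le_one fun z hz => by
          rw [norm_pow, norm_norm]
          gcongr
          exact herror z hz)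

theorem IsHomogeneousSolution.eq_zero (h : IsHomogeneousSolution γ F g)
    (hγ : ∀ i j, AnalyticOnNhd ℂ (fun z => γ z i j) (sphere 0 1))
    (hinv : ∀ z ∈ sphere (0 : ℂ) 1, IsUnit (γ z))
    (hD : ¬ Tendsto (fun N : ℕ => toeplitzDet γ N / geometricMean γ ^ (N + 1)) atTop (𝓝 0)) :
    (∀ z ∈ closedBall (0 : ℂ) 1, F z = 0) ∧ ∀ w ∈ closedBall (0 : ℂ) 1, g w = 0 := by
  obtain ⟨B, r, hr0, hr1, hB⟩ := h.exists_norm_circleCoeff_le hγ hinv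
  have hcoeff (k : ℕ) : circleCoeff g k = 0 := by
    rcases k with - | q
    · exact h.circleCoeff_zero
    ext i
    by_contra hne
    obtain ⟨C, hC⟩ :=
      h.exists_norm_truncation_vecMul_le (continuousOn_of_analyticOnNhd hγ) hr0.le hr1 hB
    exact hD (tendsto_toeplitzDet_div_zero (continuousOn_of_analyticOnNhd hγ) hinv hne hr0 hr1 hC)
  have hg (w) (hw : w ∈ closedBall (0 : ℂ) 1) : g w = 0 := by
    have hseries := hasSum_pow_smul_circleCoeff_of_summable h.outside (by simp [hcoeff]) hw
    simp only [hcoeff, smul_zero] at hseries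
    exact hseries.unique hasSum_zero
  refine ⟨?_, hg⟩
  rw [← closure_ball (0 : ℂ) one_ne_zero]
  refine Complex.eqOn_closure_of_eqOn_frontier (g := fun _ => 0) isBounded_ball h.inside
    diffContOnCl_const fun z hz => ?_
  rw [frontier_ball _ one_ne_zero] at hz
  rw [h.jump z hz, hg z⁻¹ (by simp [mem_sphere_zero_iff_norm.1 hz]), Matrix.zero_vecMul]

theorem IsRHSolution.isHomogeneousSolution_sub {C : Matrix (Fin n) (Fin m) ℂ}
    {φp φm ψp ψm : ℂ → Matrix (Fin n) (Fin m) ℂ} (hφ : IsRHSolution γ C φp φm)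
    (hψ : IsRHSolution γ C ψp ψm) (j : Fin m) :
    IsHomogeneousSolution γ (fun z i => φp z i j - ψp z i j)
      (Function.update (fun w i => φm w⁻¹ i j - ψm w⁻¹ i j) 0 0) where
  inside := diffContOnCl_pi.2 fun i => (hφ.inside i j).sub (hψ.inside i j)
  outside := diffContOnCl_update_comp_inv (f := fun z i => φm z i j - ψm z i j)
    (diffContOnCl_pi.2 fun i => (hφ.outside i j).sub (hψ.outside i j))
    (tendsto_pi_nhds.2 fun i => by
      simpa using (hφ.at_infinity i j).sub (hψ.at_infinity i j))
  jump z hz := by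
    ext l
    rw [Function.update_of_ne (inv_ne_zero (ne_zero_of_mem_unit_sphere hz)), inv_inv]
    simp only [hφ.jump z hz, hψ.jump z hz, Matrix.mul_apply, Matrix.transpose_apply,
      Matrix.vecMul, dotProduct, sub_mul, sum_sub_distrib, mul_comm (γ z _ l)]
  at_infinity := Function.update_self ..

end HomogeneousProblem

end BlockToeplitz

theorem mainTheorem6_general {n m : ℕ} {γ : ℂ → Matrix (Fin n) (Fin n) ℂ}
    (hγ : ∀ i j, AnalyticOnNhd ℂ (fun z => γ z i j) (Metric.sphere 0 1))
    (hinv : ∀ z ∈ Metric.sphere (0 : ℂ) 1, IsUnit (γ z))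
    (hD : ¬ Filter.Tendsto (fun N : ℕ => BlockToeplitz.toeplitzDet γ N /
      BlockToeplitz.geometricMean γ ^ (N + 1)) Filter.atTop (nhds 0))
    {C : Matrix (Fin n) (Fin m) ℂ} {φp φm ψp ψm : ℂ → Matrix (Fin n) (Fin m) ℂ}
    (hφ : BlockToeplitz.IsRHSolution γ C φp φm)
    (hψ : BlockToeplitz.IsRHSolution γ C ψp ψm) :
    (∀ z : ℂ, ‖z‖ ≤ 1 → φp z = ψp z) ∧ (∀ z : ℂ, 1 ≤ ‖z‖ → φm z = ψm z) := by
  have hzero (j : Fin m) := (hφ.isHomogeneousSolution_sub hψ j).eq_zero hγ hinv hD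
  refine ⟨fun z hz => ?_, fun z hz => ?_⟩ <;> ext i j <;> refine sub_eq_zero.1 ?_
  · exact congrFun ((hzero j).1 z (mem_closedBall_zero_iff.2 hz)) i
  · have hz0 : z⁻¹ ≠ 0 := inv_ne_zero (norm_pos_iff.1 (by linarith))
    simpa [Function.update_of_ne hz0] using congrFun ((hzero j).2 z⁻¹
      (by simpa using inv_le_one_of_one_le₀ hz)) i

theorem mainTheorem6 {n m : ℕ} (γ : ℂ → Matrix (Fin n) (Fin n) ℂ)
    (hγ : ∀ i j, AnalyticOnNhd ℂ (fun z => γ z i j) (Metric.sphere 0 1))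
    (hinv : ∀ z ∈ Metric.sphere (0 : ℂ) 1, IsUnit (γ z))
    (harg : BlockToeplitz.ZeroArgVariation γ)
    (hD : BlockToeplitz.szegoWidomConstant γ ≠ 0)
    (C : Matrix (Fin n) (Fin m) ℂ) (φp φm ψp ψm : ℂ → Matrix (Fin n) (Fin m) ℂ)
    (hφ : BlockToeplitz.IsRHSolution γ C φp φm)
    (hψ : BlockToeplitz.IsRHSolution γ C ψp ψm) :
    (∀ z : ℂ, ‖z‖ ≤ 1 → φp z = ψp z) ∧ (∀ z : ℂ, 1 ≤ ‖z‖ → φm z = ψm z) :=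
  mainTheorem6_general hγ hinv (fun h => hD h.limUnder_eq) hφ hψ
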